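/- Conventions. A star operation on an integral domain $A$ with quotient field $L$ is a map $E\mapsto E^{\star}$ on the nonzero fractional ideals of $A$ such that, for all nonzero $x\in L$ and all nonzero fractional ideals $E,F$: $(xA)^\star=xA$ and $(xE)^\star=xE^\star$; $E\subseteq F$ implies $E^\star\subseteq F^\star$; $E\subseteq E^\star=(E^\star)^\star$. It is of finite type if $E^\star=\bigcup F^\star$ for every $E$, the union being over the nonzero finitely generated $A$-submodules $F\subseteq E$. Put $I^{-1}=(A:_L I)$ and $I^{v_A}=(I^{-1})^{-1}$. Let $\mathrm{Inv}^\star(A)$ be the abelian group, under $(I,J)\mapsto (IJ)^\star$, of the nonzero fractional ideals $I$ with $I=I^\star$ and $(II^{-1})^\star=A$, and let $\mathrm{Cl}^\star(A)$ be its quotient by the subgroup of nonzero principal fractional ideals. Setting. Let $T$ be an integral domain with quotient field $K$, $M$ a nonzero maximal ideal of $T$, $k=T/M$, $\varphi:T\to k$ the canonical projection, $D\subsetneq k$ a proper subring whose quotient field is $k$, and $R=\varphi^{-1}(D)$; then $R$ also has quotient field $K$, $M$ is a nonzero ideal of $R$ and of $T$, and $\varphi$ restricts to a surjection $R\to D$.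 For a star operation $\ast$ on $R$ let $\ast_\varphi$ be the star operation on $D$ given by $$F^{\ast_\varphi}=\bigcap\{\,y\,\varphi\big((\varphi^{-1}(y^{-1}F))^\ast\big) : y\in k,\ F\subseteq yD\,\},$$ and let $(\ast)_T$ be the star operation on $T$ given by $E^{(\ast)_T}=E^\ast\cap(T:(T:E))$. Theorem. Suppose that the homomorphism $\mathcal U(T)\to k^{\bullet}/\mathcal U(D)$, $u\mapsto\varphi(u)\,\mathcal U(D)$, is surjective, where $\mathcal U$ denotes the group of units and $k^\bullet=k\setminus\{0\}$, and that $\ast$ is a star operation of finite type on $R$. Then $$\bar\alpha:\mathrm{Cl}^{\ast_\varphi}(D)\to \mathrm{Cl}^{\ast}(R),\ [J]\mapsto[\varphi^{-1}(J)],\qquad \bar\beta:\mathrm{Cl}^{\ast}(R)\to\mathrm{Cl}^{(\ast)_T}(T),\ [H]\mapsto[HT],$$ $$\bar\gamma:\mathrm{Cl}^{\ast}(R)\to\mathrm{Cl}^{\ast_\varphi}(D),\ [H]\mapsto[\varphi(H')^{v_D}]\quad\text{where } H=zH',\ 0\ne z\in K,\ H' \text{ an ideal of } R,\ H'\not\subseteq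 M,$$ are well-defined group homomorphisms (each $H\in\mathrm{Inv}^\ast(R)$ can be written as such a product $zH'$, and the class $[\varphi(H')^{v_D}]$ does not depend on the choice), the sequence $$0\to \mathrm{Cl}^{\ast_\varphi}(D)\xrightarrow{\ \bar\alpha\ }\mathrm{Cl}^{\ast}(R)\xrightarrow{\ \bar\beta\ }\mathrm{Cl}^{(\ast)_T}(T)\to 0$$ is exact, and it is split by $\bar\gamma$, that is, $\bar\gamma\circ\bar\alpha$ is the identity of $\mathrm{Cl}^{\ast_\varphi}(D)$. -/

import Mathlib

open scoped nonZeroDivisors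

/-- A star operation on the integral domain `A` with quotient field `K`.
A star operation is a self-map of the set of nonzero fractional ideals; here it is extended to all
fractional ideals by the convention `map_zero'`, so that it is determined by its values on the
nonzero ones (and it preserves them, by `le_map'`). -/
structure StarOperation (A K : Type*) [CommRing A] [IsDomain A] [Field K] [Algebra A K]
    [IsFractionRing A K] where
  toFun : FractionalIdeal A⁰ K → FractionalIdeal A⁰ K
  map_zero' : toFun 0 = 0
  map_spanSingleton' : ∀ x : K, x ≠ 0 →
    toFun (FractionalIdeal.spanSingleton A⁰ x) = FractionalIdeal.spanSingleton A⁰ x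
  map_spanSingleton_mul' : ∀ (x : K) (E : FractionalIdeal A⁰ K), x ≠ 0 → E ≠ 0 →
    toFun (FractionalIdeal.spanSingleton A⁰ x * E) = FractionalIdeal.spanSingleton A⁰ x * toFun E
  mono' : ∀ E F : FractionalIdeal A⁰ K, E ≠ 0 → E ≤ F → toFun E ≤ toFun F
  le_map' : ∀ E : FractionalIdeal A⁰ K, E ≠ 0 → E ≤ toFun E
  idem' : ∀ E : FractionalIdeal A⁰ K, E ≠ 0 → toFun (toFun E) = toFun E

namespace StarOperation

section Basic

variable {A K : Type*} [CommRing A] [IsDomain A] [Field K] [Algebra A K] [IsFractionRing A K]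

instance : CoeFun (StarOperation A K) (fun _ => FractionalIdeal A⁰ K → FractionalIdeal A⁰ K) :=
  ⟨StarOperation.toFun⟩

/-- `s` is of finite type: `E^s` is the union of the `F^s`, where `F` runs over the nonzero
finitely generated `A`-submodules of `E`. -/
def IsFiniteType (s : StarOperation A K) : Prop :=
  ∀ E : FractionalIdeal A⁰ K, E ≠ 0 →
    (s E : Set K) = ⋃ F ∈ {F : FractionalIdeal A⁰ K |
      F ≠ 0 ∧ (F : Submodule A K).FG ∧ F ≤ E}, (s F : Set K)

/-- `I` is an `s`-ideal that is `s`-invertible, that is, `I^s = I` and `(I I⁻¹)^s = A`. -/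
def IsInvertibleStarIdeal (s : StarOperation A K) (I : FractionalIdeal A⁰ K) : Prop :=
  I ≠ 0 ∧ s I = I ∧ s (I * I⁻¹) = 1

variable (s : StarOperation A K)

theorem map_one : s 1 = 1 := by
  have := s.map_spanSingleton' 1 one_ne_zero
  rwa [FractionalIdeal.spanSingleton_one] at this

theorem map_smul (x : K) (E : FractionalIdeal A⁰ K) :
    s (FractionalIdeal.spanSingleton A⁰ x * E) = FractionalIdeal.spanSingleton A⁰ x * s E := by
  by_cases hx : x = 0
  · simp [hx, s.map_zero']
  by_cases hE : E = 0
  · simp [hE, s.map_zero']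
  exact s.map_spanSingleton_mul' x E hx hE

theorem le_map (E : FractionalIdeal A⁰ K) : E ≤ s E := by
  by_cases hE : E = 0
  · simp [hE, s.map_zero']
  exact s.le_map' E hE

theorem mono {E F : FractionalIdeal A⁰ K} (h : E ≤ F) : s E ≤ s F := by
  by_cases hE : E = 0
  · simp [hE, s.map_zero']
  exact s.mono' E F hE h

theorem idem (E : FractionalIdeal A⁰ K) : s (s E) = s E := by
  by_cases hE : E = 0
  · simp [hE, s.map_zero']
  exact s.idem' E hE

theorem map_mul_le (I J : FractionalIdeal A⁰ K) : s I * J ≤ s (I * J) := by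
  rw [FractionalIdeal.mul_le]
  intro x hx y hy
  have h1 : y * x ∈ FractionalIdeal.spanSingleton A⁰ y * s I :=
    FractionalIdeal.mul_mem_mul (FractionalIdeal.mem_spanSingleton_self _ y) hx
  rw [← s.map_smul] at h1
  rw [mul_comm x y]
  refine s.mono ?_ h1
  rw [mul_comm I J]
  exact mul_le_mul_left ((FractionalIdeal.spanSingleton_le_iff_mem).2 hy) I

theorem map_mul_left (I J : FractionalIdeal A⁰ K) : s (s I * J) = s (I * J) := by
  apply le_antisymm
  · have := s.mono (s.map_mul_le I J)
    rwa [s.idem] at this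
  · exact s.mono (mul_le_mul_left (s.le_map I) J)

theorem map_mul_right (I J : FractionalIdeal A⁰ K) : s (I * s J) = s (I * J) := by
  rw [mul_comm, s.map_mul_left, mul_comm]

theorem ne_zero_of_map_mul {I J : FractionalIdeal A⁰ K} (h : s (I * J) = 1) : I ≠ 0 := by
  rintro rfl
  rw [zero_mul, s.map_zero'] at h
  exact zero_ne_one h

theorem map_mul_inv_of_map_mul {I J : FractionalIdeal A⁰ K} (h : s (I * J) = 1) :
    s (I * I⁻¹) = 1 := by
  have h0 : I ≠ 0 := s.ne_zero_of_map_mul h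
  have h1 : J ≤ I⁻¹ := by
    rw [FractionalIdeal.inv_eq, FractionalIdeal.le_div_iff_mul_le h0, mul_comm, ← h]
    exact s.le_map _
  apply le_antisymm
  · have := s.mono (FractionalIdeal.mul_one_div_le_one (I := I))
    rwa [s.map_one] at this
  · rw [← h, mul_comm I J, mul_comm I I⁻¹]
    exact s.mono (mul_le_mul_left h1 I)

theorem isInvertibleStarIdeal_of_map_mul {I J : FractionalIdeal A⁰ K} (hI : s I = I)
    (h : s (I * J) = 1) : s.IsInvertibleStarIdeal I :=
  ⟨s.ne_zero_of_map_mul h, hI, s.map_mul_inv_of_map_mul h⟩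

variable {s} in
theorem IsInvertibleStarIdeal.inv {I : FractionalIdeal A⁰ K} (hI : s.IsInvertibleStarIdeal I) :
    s.IsInvertibleStarIdeal I⁻¹ := by
  refine s.isInvertibleStarIdeal_of_map_mul (J := I) ?_ (by rw [mul_comm]; exact hI.2.2)
  apply le_antisymm _ (s.le_map _)
  rw [FractionalIdeal.inv_eq, FractionalIdeal.le_div_iff_mul_le hI.1, ← FractionalIdeal.inv_eq,
    ← hI.2.2, mul_comm I]
  exact s.map_mul_le _ _

variable {s} in
theorem IsInvertibleStarIdeal.mul {I J : FractionalIdeal A⁰ K} (hI : s.IsInvertibleStarIdeal I)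
    (hJ : s.IsInvertibleStarIdeal J) : s.IsInvertibleStarIdeal (s (I * J)) := by
  refine s.isInvertibleStarIdeal_of_map_mul (J := I⁻¹ * J⁻¹) (s.idem _) ?_
  rw [s.map_mul_left, mul_mul_mul_comm, ← s.map_mul_left, hI.2.2, one_mul, hJ.2.2]

theorem isInvertibleStarIdeal_spanSingleton (x : Kˣ) :
    s.IsInvertibleStarIdeal (FractionalIdeal.spanSingleton A⁰ (x : K)) := by
  refine s.isInvertibleStarIdeal_of_map_mul
    (J := FractionalIdeal.spanSingleton A⁰ ((x : K)⁻¹)) (s.map_spanSingleton' _ x.ne_zero) ?_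
  rw [FractionalIdeal.spanSingleton_mul_spanSingleton, mul_inv_cancel₀ x.ne_zero,
    FractionalIdeal.spanSingleton_one, s.map_one]

/-- The set `Inv^s(A)` of `s`-invertible `s`-ideals of `A`. -/
def InvIdeals : Type _ := {I : FractionalIdeal A⁰ K // s.IsInvertibleStarIdeal I}

/-- The abelian group structure on `Inv^s(A)`: the product is the `s`-multiplication
`(I, J) ↦ (I J)^s`, the identity is `A`, and the inverse of `I` is `I⁻¹ = (A : I)`. -/
noncomputable instance : CommGroup s.InvIdeals where
  mul I J := ⟨s (I.1 * J.1), I.2.mul J.2⟩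
  one := ⟨1, by simpa using s.isInvertibleStarIdeal_spanSingleton 1⟩
  inv I := ⟨I.1⁻¹, I.2.inv⟩
  mul_assoc I J L := Subtype.ext <| by
    change s (s (I.1 * J.1) * L.1) = s (I.1 * s (J.1 * L.1))
    rw [s.map_mul_left, s.map_mul_right, mul_assoc]
  one_mul I := Subtype.ext <| by
    change s (1 * I.1) = I.1
    rw [one_mul, I.2.2.1]
  mul_one I := Subtype.ext <| by
    change s (I.1 * 1) = I.1
    rw [mul_one, I.2.2.1]
  inv_mul_cancel I := Subtype.ext <| by
    change s (I.1⁻¹ * I.1) = 1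
    rw [mul_comm, I.2.2.2]
  mul_comm I J := Subtype.ext <| by
    change s (I.1 * J.1) = s (J.1 * I.1)
    rw [mul_comm]

/-- The homomorphism sending `x ≠ 0` in `K` to the principal fractional ideal `xA`. -/
noncomputable def principal : Kˣ →* s.InvIdeals where
  toFun x := ⟨FractionalIdeal.spanSingleton A⁰ (x : K), s.isInvertibleStarIdeal_spanSingleton x⟩
  map_one' := Subtype.ext <| by
    change FractionalIdeal.spanSingleton A⁰ ((1 : Kˣ) : K) = 1
    simp
  map_mul' x y := Subtype.ext <| by
    change FractionalIdeal.spanSingleton A⁰ ((x * y : Kˣ) : K) =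
      s (FractionalIdeal.spanSingleton A⁰ (x : K) * FractionalIdeal.spanSingleton A⁰ (y : K))
    rw [FractionalIdeal.spanSingleton_mul_spanSingleton, Units.val_mul,
      s.map_spanSingleton' _ (mul_ne_zero x.ne_zero y.ne_zero)]

/-- The subgroup `Prin(A)` of the nonzero principal fractional ideals. -/
noncomputable def Prin : Subgroup s.InvIdeals := s.principal.range

/-- The class group `Cl^s(A) = Inv^s(A) / Prin(A)`. -/
abbrev Cl : Type _ := s.InvIdeals ⧸ s.Prin

/-- The class `[I]` in `Cl^s(A)` of an `s`-invertible `s`-ideal `I`. -/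
noncomputable abbrev cls (I : FractionalIdeal A⁰ K) (hI : s.IsInvertibleStarIdeal I) : s.Cl :=
  QuotientGroup.mk (⟨I, hI⟩ : s.InvIdeals)

end Basic

section Projection

variable {A K B L : Type*} [CommRing A] [IsDomain A] [Field K] [Algebra A K] [IsFractionRing A K]
  [CommRing B] [IsDomain B] [Field L] [Algebra B L] [IsFractionRing B L]

/-- The integral ideal `(y⁻¹F) ∩ B = {b ∈ B | y b ∈ F}` of `B`; it is `y⁻¹F` if
`0 ≠ F ⊆ yB`. -/
def scaledIdeal (F : FractionalIdeal B⁰ L) (y : L) : Ideal B where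
  carrier := {b | y * algebraMap B L b ∈ F}
  zero_mem' := by simpa using F.zero_mem
  add_mem' := by
    intro a b ha hb
    simp only [Set.mem_ofPred_eq, map_add, mul_add] at *
    exact Submodule.add_mem (F : Submodule B L) ha hb
  smul_mem' := by
    intro c b hb
    simp only [Set.mem_ofPred_eq, smul_eq_mul, _root_.map_mul] at *
    have := Submodule.smul_mem (F : Submodule B L) c hb
    rw [Algebra.smul_def] at this
    rw [mul_left_comm]
    exact this

/-- The value `I^s` at an integral ideal `I` of `A`, as an integral ideal (`I^s ⊆ A^s = A`). -/
def idealClosure (s : StarOperation A K) (I : Ideal A) : Ideal A where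
  carrier := {a | algebraMap A K a ∈ s (I : FractionalIdeal A⁰ K)}
  zero_mem' := by simpa using (s (I : FractionalIdeal A⁰ K)).zero_mem
  add_mem' := by
    intro a b ha hb
    simp only [Set.mem_ofPred_eq, map_add] at *
    exact Submodule.add_mem (s (I : FractionalIdeal A⁰ K) : Submodule A K) ha hb
  smul_mem' := by
    intro c b hb
    simp only [Set.mem_ofPred_eq, smul_eq_mul, _root_.map_mul] at *
    have := Submodule.smul_mem (s (I : FractionalIdeal A⁰ K) : Submodule A K) c hb
    rwa [Algebra.smul_def] at this

/-- The fractional ideal `y φ((φ⁻¹(y⁻¹F))^s)` of `B`, for `0 ≠ F ⊆ yB`. -/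
noncomputable def projTerm (s : StarOperation A K) (φ : A →+* B) (F : FractionalIdeal B⁰ L)
    (y : L) : FractionalIdeal B⁰ L :=
  FractionalIdeal.spanSingleton B⁰ y *
    ((Ideal.map φ (s.idealClosure (Ideal.comap φ (scaledIdeal F y))) : Ideal B) :
      FractionalIdeal B⁰ L)

variable (s : StarOperation A K) (φ : A →+* B)

theorem exists_le_spanSingleton (F : FractionalIdeal B⁰ L) :
    ∃ y : L, F ≤ FractionalIdeal.spanSingleton B⁰ y := by
  obtain ⟨a, I, _, rfl⟩ := FractionalIdeal.exists_eq_spanSingleton_mul F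
  refine ⟨(algebraMap B L a)⁻¹, ?_⟩
  calc FractionalIdeal.spanSingleton B⁰ (algebraMap B L a)⁻¹ * (I : FractionalIdeal B⁰ L)
      ≤ FractionalIdeal.spanSingleton B⁰ (algebraMap B L a)⁻¹ * 1 :=
        mul_le_mul_right FractionalIdeal.coeIdeal_le_one _
    _ = _ := mul_one _

theorem projTerm_le (F : FractionalIdeal B⁰ L) (y : L) :
    s.projTerm φ F y ≤ FractionalIdeal.spanSingleton B⁰ y :=
  calc s.projTerm φ F y ≤ FractionalIdeal.spanSingleton B⁰ y * 1 :=
        mul_le_mul_right FractionalIdeal.coeIdeal_le_one _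
    _ = _ := mul_one _

/-- The fractional ideal `F^{s_φ}`, the intersection of all the `y φ((φ⁻¹(y⁻¹F))^s)` with `y ∈ L`
and `F ⊆ yB`. (For `F = 0` it is `0`, because of the term with `y = 0`.) -/
noncomputable def projFun (F : FractionalIdeal B⁰ L) : FractionalIdeal B⁰ L :=
  ⟨⨅ y ∈ {y : L | F ≤ FractionalIdeal.spanSingleton B⁰ y}, (s.projTerm φ F y : Submodule B L), by
    obtain ⟨y, hy⟩ := exists_le_spanSingleton F
    exact FractionalIdeal.isFractional_of_le (J := s.projTerm φ F y) (iInf₂_le y hy)⟩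

theorem mem_projFun {F : FractionalIdeal B⁰ L} {z : L} : z ∈ s.projFun φ F ↔
    ∀ y : L, F ≤ FractionalIdeal.spanSingleton B⁰ y → z ∈ s.projTerm φ F y := by
  rw [← FractionalIdeal.mem_coe]
  simp only [projFun, FractionalIdeal.coe_mk, Submodule.mem_iInf, Set.mem_ofPred_eq,
    FractionalIdeal.mem_coe]

variable {φ} in
theorem mem_projTerm (hφ : Function.Surjective φ) {F : FractionalIdeal B⁰ L} {y z : L} :
    z ∈ s.projTerm φ F y ↔ ∃ a ∈ s.idealClosure (Ideal.comap φ (scaledIdeal F y)),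
      z = y * algebraMap B L (φ a) := by
  rw [projTerm, FractionalIdeal.mem_singleton_mul]
  constructor
  · rintro ⟨w, hw, rfl⟩
    obtain ⟨b, hb, rfl⟩ := (FractionalIdeal.mem_coeIdeal _).1 hw
    obtain ⟨a, ha, rfl⟩ := (Ideal.mem_map_iff_of_surjective φ hφ).1 hb
    exact ⟨a, ha, rfl⟩
  · rintro ⟨a, ha, rfl⟩
    exact ⟨_, FractionalIdeal.mem_coeIdeal_of_mem _ (Ideal.mem_map_of_mem φ ha), rfl⟩

theorem le_idealClosure (I : Ideal A) : I ≤ s.idealClosure I := fun _ ha =>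
  s.le_map _ (FractionalIdeal.mem_coeIdeal_of_mem _ ha)

theorem idealClosure_mono {I J : Ideal A} (h : I ≤ J) : s.idealClosure I ≤ s.idealClosure J :=
  fun _ ha => s.mono ((FractionalIdeal.coeIdeal_le_coeIdeal K).2 h) ha

theorem idealClosure_idem (I : Ideal A) : s.idealClosure (s.idealClosure I) = s.idealClosure I := by
  apply le_antisymm _ (s.le_idealClosure _)
  intro a ha
  have h : ((s.idealClosure I : Ideal A) : FractionalIdeal A⁰ K) ≤ s I := by
    intro x hx
    obtain ⟨b, hb, rfl⟩ := (FractionalIdeal.mem_coeIdeal _).1 hx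
    exact hb
  have h' := s.mono h ha
  rwa [s.idem] at h'

variable {φ} in
theorem le_projFun (hφ : Function.Surjective φ) (F : FractionalIdeal B⁰ L) :
    F ≤ s.projFun φ F := by
  intro z hz
  rw [mem_projFun]
  intro y hy
  obtain ⟨b, rfl⟩ := (FractionalIdeal.mem_spanSingleton _).1 (hy hz)
  obtain ⟨a, rfl⟩ := hφ b
  rw [mem_projTerm s hφ]
  refine ⟨a, s.le_idealClosure _ ?_, by rw [Algebra.smul_def, mul_comm]⟩
  change y * algebraMap B L (φ a) ∈ F
  rwa [mul_comm, ← Algebra.smul_def]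

theorem projFun_le {F : FractionalIdeal B⁰ L} {y : L}
    (hy : F ≤ FractionalIdeal.spanSingleton B⁰ y) :
    s.projFun φ F ≤ FractionalIdeal.spanSingleton B⁰ y :=
  fun _ hz => s.projTerm_le φ F y ((mem_projFun s φ).1 hz y hy)

variable {φ} in
theorem projFun_mono (hφ : Function.Surjective φ) {E F : FractionalIdeal B⁰ L} (h : E ≤ F) :
    s.projFun φ E ≤ s.projFun φ F := by
  intro z hz
  rw [mem_projFun] at hz ⊢
  intro y hy
  have := hz y (h.trans hy)
  rw [mem_projTerm s hφ] at this ⊢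
  obtain ⟨a, ha, rfl⟩ := this
  exact ⟨a, s.idealClosure_mono (fun b hb => h hb) ha, rfl⟩

variable {φ} in
theorem projFun_idem (hφ : Function.Surjective φ) (F : FractionalIdeal B⁰ L) :
    s.projFun φ (s.projFun φ F) = s.projFun φ F := by
  apply le_antisymm _ (s.le_projFun hφ _)
  intro z hz
  rw [mem_projFun] at hz ⊢
  intro y hy
  by_cases hy0 : y = 0
  · subst hy0
    have := hz 0 (s.projFun_le φ hy)
    simpa [projTerm] using this
  have := hz y (s.projFun_le φ hy)
  rw [mem_projTerm s hφ] at this ⊢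
  obtain ⟨a, ha, rfl⟩ := this
  refine ⟨a, ?_, rfl⟩
  have key : Ideal.comap φ (scaledIdeal (s.projFun φ F) y) ≤
      s.idealClosure (Ideal.comap φ (scaledIdeal F y)) := by
    intro c hc
    have h1 := (mem_projFun s φ).1 (show y * algebraMap B L (φ c) ∈ s.projFun φ F from hc) y hy
    rw [mem_projTerm s hφ] at h1
    obtain ⟨d, hd, h2⟩ := h1
    have h3 : φ c = φ d := IsFractionRing.injective B L (mul_left_cancel₀ hy0 h2)
    have h4 : c - d ∈ Ideal.comap φ (scaledIdeal F y) := by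
      rw [Ideal.mem_comap, map_sub, h3, sub_self]
      exact Ideal.zero_mem _
    have h5 := Ideal.add_mem _ (s.le_idealClosure _ h4) hd
    rwa [sub_add_cancel] at h5
  have := s.idealClosure_mono key ha
  rwa [s.idealClosure_idem] at this

variable {φ} in
theorem projFun_smul_le (hφ : Function.Surjective φ) {x : L} (hx : x ≠ 0)
    (F : FractionalIdeal B⁰ L) : s.projFun φ (FractionalIdeal.spanSingleton B⁰ x * F) ≤
      FractionalIdeal.spanSingleton B⁰ x * s.projFun φ F := by
  intro z hz
  rw [mem_projFun] at hz
  rw [FractionalIdeal.mem_singleton_mul]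
  refine ⟨x⁻¹ * z, ?_, by rw [mul_inv_cancel_left₀ hx]⟩
  rw [mem_projFun]
  intro y hy
  have h1 : FractionalIdeal.spanSingleton B⁰ x * F ≤ FractionalIdeal.spanSingleton B⁰ (x * y) := by
    rw [← FractionalIdeal.spanSingleton_mul_spanSingleton]
    exact mul_le_mul_right hy _
  have h2 := hz (x * y) h1
  rw [mem_projTerm s hφ] at h2 ⊢
  obtain ⟨a, ha, rfl⟩ := h2
  refine ⟨a, ?_, by rw [mul_assoc, inv_mul_cancel_left₀ hx]⟩
  refine s.idealClosure_mono ?_ ha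
  intro b hb
  change x * y * algebraMap B L (φ b) ∈ FractionalIdeal.spanSingleton B⁰ x * F at hb
  change y * algebraMap B L (φ b) ∈ F
  rw [FractionalIdeal.mem_singleton_mul] at hb
  obtain ⟨w, hw, h⟩ := hb
  rw [mul_assoc] at h
  rwa [mul_left_cancel₀ hx h]

/-- The projection `s_φ` of a star operation `s` on `A` along a surjective homomorphism
`φ : A → B` of integral domains. -/
noncomputable def proj (hφ : Function.Surjective φ) : StarOperation B L where
  toFun := s.projFun φ
  map_zero' := by
    apply le_antisymm _ (FractionalIdeal.zero_le _)
    have := s.projFun_le φ (F := (0 : FractionalIdeal B⁰ L)) (y := 0) (by simp)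
    simpa using this
  map_spanSingleton' x _ :=
    le_antisymm (s.projFun_le φ le_rfl) (s.le_projFun hφ _)
  map_spanSingleton_mul' x E hx _ := by
    apply le_antisymm (s.projFun_smul_le hφ hx E)
    have h := s.projFun_smul_le hφ (inv_ne_zero hx) (FractionalIdeal.spanSingleton B⁰ x * E)
    rw [← mul_assoc, FractionalIdeal.spanSingleton_mul_spanSingleton, inv_mul_cancel₀ hx,
      FractionalIdeal.spanSingleton_one, one_mul] at h
    calc _ ≤ FractionalIdeal.spanSingleton B⁰ x * _ := mul_le_mul_right h _
      _ = _ := by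
        rw [← mul_assoc, FractionalIdeal.spanSingleton_mul_spanSingleton, mul_inv_cancel₀ hx,
          FractionalIdeal.spanSingleton_one, one_mul]
  mono' E F _ h := s.projFun_mono hφ h
  le_map' E _ := s.le_projFun hφ E
  idem' E _ := s.projFun_idem hφ E

end Projection

section Extension

variable {T K : Type*} [CommRing T] [IsDomain T] [Field K] [Algebra T K] [IsFractionRing T K]
  {R : Subring T}

/-- If `(R : T) ≠ 0`, a fractional ideal of `T` is a fractional ideal of `R`. -/
def restrictIdeal (hR : ∃ c : T, c ≠ 0 ∧ ∀ t : T, c * t ∈ R) (E : FractionalIdeal T⁰ K) :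
    FractionalIdeal R⁰ K :=
  ⟨(E : Submodule T K).restrictScalars R, by
    obtain ⟨c, hc, h⟩ := hR
    obtain ⟨d, hd, hE⟩ := E.isFractional
    refine ⟨⟨c * (c * d), h _⟩, ?_, ?_⟩
    · rw [mem_nonZeroDivisors_iff_ne_zero]
      intro h0
      exact mul_ne_zero hc (mul_ne_zero hc (nonZeroDivisors.ne_zero hd)) (congrArg Subtype.val h0)
    · intro b hb
      obtain ⟨t, ht⟩ := hE b hb
      refine ⟨⟨c * (c * t), h _⟩, ?_⟩
      change algebraMap T K (c * (c * t)) = (c * (c * d)) • b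
      rw [mul_smul, mul_smul, ← ht, Algebra.smul_def, Algebra.smul_def, map_mul, map_mul]⟩

theorem mem_restrictIdeal (hR : ∃ c : T, c ≠ 0 ∧ ∀ t : T, c * t ∈ R) (E : FractionalIdeal T⁰ K)
    (x : K) : x ∈ restrictIdeal hR E ↔ x ∈ E := Iff.rfl

variable [IsFractionRing R K] (s : StarOperation R K)
  (hR : ∃ c : T, c ≠ 0 ∧ ∀ t : T, c * t ∈ R)

theorem smul_mem_restrict (E : FractionalIdeal T⁰ K) (t : T) {x : K}
    (hx : x ∈ s (restrictIdeal hR E)) : t • x ∈ s (restrictIdeal hR E) := by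
  have h1 : algebraMap T K t * x ∈
      FractionalIdeal.spanSingleton R⁰ (algebraMap T K t) * s (restrictIdeal hR E) :=
    FractionalIdeal.mul_mem_mul (FractionalIdeal.mem_spanSingleton_self _ _) hx
  rw [← s.map_smul] at h1
  rw [Algebra.smul_def]
  refine s.mono ?_ h1
  rw [FractionalIdeal.spanSingleton_mul_le_iff]
  intro z hz
  rw [← Algebra.smul_def]
  exact Submodule.smul_mem (E : Submodule T K) t hz

/-- The fractional ideal `E^{(s)_T} = E^s ∩ (T : (T : E))` of `T`. -/
noncomputable def extFun (E : FractionalIdeal T⁰ K) : FractionalIdeal T⁰ K :=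
  ⟨{ carrier := {x | x ∈ s (restrictIdeal hR E) ∧ x ∈ (E⁻¹)⁻¹}
     zero_mem' := ⟨FractionalIdeal.zero_mem _, FractionalIdeal.zero_mem _⟩
     add_mem' := fun ha hb =>
      ⟨Submodule.add_mem (s (restrictIdeal hR E) : Submodule R K) ha.1 hb.1,
        Submodule.add_mem (((E⁻¹)⁻¹ : FractionalIdeal T⁰ K) : Submodule T K) ha.2 hb.2⟩
     smul_mem' := fun t _ hx =>
      ⟨s.smul_mem_restrict hR E t hx.1,
        Submodule.smul_mem (((E⁻¹)⁻¹ : FractionalIdeal T⁰ K) : Submodule T K) t hx.2⟩ },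
    FractionalIdeal.isFractional_of_le (J := (E⁻¹)⁻¹) (fun _ hx => hx.2)⟩

theorem mem_extFun {E : FractionalIdeal T⁰ K} {x : K} :
    x ∈ s.extFun hR E ↔ x ∈ s (restrictIdeal hR E) ∧ x ∈ (E⁻¹)⁻¹ := Iff.rfl

theorem inv_ne_zero_of {E : FractionalIdeal T⁰ K} (hE : E ≠ 0) : E⁻¹ ≠ 0 := by
  intro h
  have h1 := FractionalIdeal.bot_lt_mul_inv (K := K) (I := E) hE
  rw [h, mul_zero] at h1
  exact lt_irrefl _ h1

theorem le_inv_inv {E : FractionalIdeal T⁰ K} (hE : E ≠ 0) : E ≤ (E⁻¹)⁻¹ := by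
  rw [FractionalIdeal.inv_eq (I := E⁻¹), FractionalIdeal.le_div_iff_mul_le (inv_ne_zero_of hE)]
  exact FractionalIdeal.mul_one_div_le_one

theorem inv_inv_mono {E F : FractionalIdeal T⁰ K} (hE : E ≠ 0) (hF : F ≠ 0) (h : E ≤ F) :
    (E⁻¹)⁻¹ ≤ (F⁻¹)⁻¹ :=
  FractionalIdeal.inv_anti_mono (inv_ne_zero_of hF) (inv_ne_zero_of hE)
    (FractionalIdeal.inv_anti_mono hE hF h)

theorem inv_inv_inv {E : FractionalIdeal T⁰ K} (hE : E ≠ 0) : ((E⁻¹)⁻¹)⁻¹ = E⁻¹ :=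
  le_antisymm
    (FractionalIdeal.inv_anti_mono hE (inv_ne_zero_of (inv_ne_zero_of hE)) (le_inv_inv hE))
    (le_inv_inv (inv_ne_zero_of hE))

theorem le_extFun {E : FractionalIdeal T⁰ K} (hE : E ≠ 0) : E ≤ s.extFun hR E := fun _ hx =>
  ⟨s.le_map _ ((mem_restrictIdeal hR E _).2 hx), le_inv_inv hE hx⟩

theorem extFun_mono {E F : FractionalIdeal T⁰ K} (hE : E ≠ 0) (hF : F ≠ 0) (h : E ≤ F) :
    s.extFun hR E ≤ s.extFun hR F := fun _ hx =>
  ⟨s.mono (fun _ hy => h hy) hx.1, inv_inv_mono hE hF h hx.2⟩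

theorem spanSingleton_mul_ne_zero {x : K} (hx : x ≠ 0) {E : FractionalIdeal T⁰ K} (hE : E ≠ 0) :
    FractionalIdeal.spanSingleton T⁰ x * E ≠ 0 := by
  intro h
  apply hE
  have := congrArg (FractionalIdeal.spanSingleton T⁰ x⁻¹ * ·) h
  simpa [← mul_assoc, FractionalIdeal.spanSingleton_mul_spanSingleton, inv_mul_cancel₀ hx]
    using this

theorem spanSingleton_mul_inv_inv {x : K} (hx : x ≠ 0) {E : FractionalIdeal T⁰ K} (hE : E ≠ 0) :
    ((FractionalIdeal.spanSingleton T⁰ x * E)⁻¹)⁻¹ ≤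
      FractionalIdeal.spanSingleton T⁰ x * (E⁻¹)⁻¹ := by
  have hxE : FractionalIdeal.spanSingleton T⁰ x * E ≠ 0 :=
    spanSingleton_mul_ne_zero hx hE
  intro z hz
  rw [FractionalIdeal.mem_singleton_mul]
  refine ⟨x⁻¹ * z, ?_, by rw [mul_inv_cancel_left₀ hx]⟩
  rw [FractionalIdeal.mem_inv_iff (inv_ne_zero_of hxE)] at hz
  rw [FractionalIdeal.mem_inv_iff (inv_ne_zero_of hE)]
  intro w hw
  have h1 : x⁻¹ * w ∈ (FractionalIdeal.spanSingleton T⁰ x * E)⁻¹ := by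
    rw [FractionalIdeal.mem_inv_iff hE] at hw
    rw [FractionalIdeal.mem_inv_iff hxE]
    intro v hv
    obtain ⟨e, he, rfl⟩ := FractionalIdeal.mem_singleton_mul.1 hv
    have := hw e he
    rwa [show x⁻¹ * w * (x * e) = w * e by field_simp]
  have := hz _ h1
  rwa [show x⁻¹ * z * w = z * (x⁻¹ * w) by ring]

theorem extFun_smul_le {x : K} (hx : x ≠ 0) {E : FractionalIdeal T⁰ K} (hE : E ≠ 0) :
    s.extFun hR (FractionalIdeal.spanSingleton T⁰ x * E) ≤
      FractionalIdeal.spanSingleton T⁰ x * s.extFun hR E := by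
  intro z hz
  have h2 := spanSingleton_mul_inv_inv hx hE hz.2
  have h1 : z ∈ FractionalIdeal.spanSingleton R⁰ x * s (restrictIdeal hR E) := by
    rw [← s.map_smul]
    refine s.mono ?_ hz.1
    intro w hw
    obtain ⟨e, he, rfl⟩ := FractionalIdeal.mem_singleton_mul.1 ((mem_restrictIdeal hR _ _).1 hw)
    exact FractionalIdeal.mem_singleton_mul.2 ⟨e, he, rfl⟩
  obtain ⟨a, ha, rfl⟩ := FractionalIdeal.mem_singleton_mul.1 h1
  obtain ⟨b, hb, hab⟩ := FractionalIdeal.mem_singleton_mul.1 h2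
  rw [FractionalIdeal.mem_singleton_mul]
  refine ⟨a, ⟨ha, ?_⟩, rfl⟩
  rwa [mul_left_cancel₀ hx hab]

theorem extFun_ne_zero {E : FractionalIdeal T⁰ K} (hE : E ≠ 0) : s.extFun hR E ≠ 0 := by
  intro h
  have := s.le_extFun hR hE
  rw [h] at this
  exact hE (le_antisymm this (FractionalIdeal.zero_le _))

/-- The extension `(s)_T` to `T` of a star operation `s` on a subring `R` with the same quotient
field and with nonzero conductor `(R : T)`: it is given by `E^{(s)_T} = E^s ∩ (T : (T : E))`. -/
noncomputable def extend : StarOperation T K where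
  toFun := s.extFun hR
  map_zero' := by
    apply le_antisymm _ (FractionalIdeal.zero_le _)
    intro x hx
    have := hx.2
    rwa [FractionalIdeal.inv_zero', FractionalIdeal.inv_zero'] at this
  map_spanSingleton' x hx := by
    have h0 : FractionalIdeal.spanSingleton T⁰ x ≠ 0 :=
      FractionalIdeal.spanSingleton_ne_zero_iff.2 hx
    apply le_antisymm _ (s.le_extFun hR h0)
    intro z hz
    have := hz.2
    rwa [FractionalIdeal.spanSingleton_inv, FractionalIdeal.spanSingleton_inv, inv_inv] at this
  map_spanSingleton_mul' x E hx hE := by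
    apply le_antisymm (s.extFun_smul_le hR hx hE)
    have hxE : FractionalIdeal.spanSingleton T⁰ x * E ≠ 0 :=
      spanSingleton_mul_ne_zero hx hE
    have h := s.extFun_smul_le hR (inv_ne_zero hx) hxE
    rw [← mul_assoc, FractionalIdeal.spanSingleton_mul_spanSingleton, inv_mul_cancel₀ hx,
      FractionalIdeal.spanSingleton_one, one_mul] at h
    calc _ ≤ FractionalIdeal.spanSingleton T⁰ x * _ := mul_le_mul_right h _
      _ = _ := by
        rw [← mul_assoc, FractionalIdeal.spanSingleton_mul_spanSingleton, mul_inv_cancel₀ hx,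
          FractionalIdeal.spanSingleton_one, one_mul]
  mono' E F hE h := s.extFun_mono hR hE
    (fun hF => hE (le_antisymm (h.trans hF.le) (FractionalIdeal.zero_le _))) h
  le_map' E hE := s.le_extFun hR hE
  idem' E hE := by
    apply le_antisymm _ (s.le_extFun hR (s.extFun_ne_zero hR hE))
    intro x hx
    refine ⟨?_, ?_⟩
    · have h1 : restrictIdeal hR (s.extFun hR E) ≤ s (restrictIdeal hR E) := fun _ hy => hy.1
      have h2 := s.mono h1 hx.1
      rwa [s.idem] at h2
    · have hv : (E⁻¹)⁻¹ ≠ 0 := inv_ne_zero_of (inv_ne_zero_of hE)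
      have h1 : s.extFun hR E ≤ (E⁻¹)⁻¹ := fun _ hy => hy.2
      have h2 := inv_inv_mono (s.extFun_ne_zero hR hE) hv h1 hx.2
      rwa [inv_inv_inv (inv_ne_zero_of hE)] at h2

/-- The extension `HT` to `T` of a fractional ideal `H` of `R`: the `T`-submodule of `K`
generated by `H`. -/
def extendIdeal (H : FractionalIdeal R⁰ K) : FractionalIdeal T⁰ K :=
  ⟨Submodule.span T (H : Set K), by
    obtain ⟨d, hd, hH⟩ := H.isFractional
    refine ⟨(d : T), ?_, ?_⟩
    · rw [mem_nonZeroDivisors_iff_ne_zero]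
      intro h0
      exact nonZeroDivisors.ne_zero hd (Subtype.ext h0)
    · intro b hb
      induction hb using Submodule.span_induction with
      | mem x hx =>
        obtain ⟨r, hr⟩ := hH x hx
        exact ⟨(r : T), hr⟩
      | zero => rw [smul_zero]; exact ⟨0, map_zero _⟩
      | add x y _ _ hx hy =>
        rw [smul_add]
        exact IsLocalization.isInteger_add hx hy
      | smul t x _ hx =>
        rw [smul_comm]
        exact IsLocalization.isInteger_smul hx⟩

end Extension

end StarOperation

section Pullback

variable {T k : Type*} [CommRing T] [IsDomain T] [Field k]

/-- The pullback `R = φ⁻¹(D)`, a subring of `T`. -/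
abbrev pullbackRing (φ : T →+* k) (D : Subring k) : Subring T := D.comap φ

/-- The restriction `φ : R → D` of `φ` to the pullback `R = φ⁻¹(D)`. -/
def pullbackProj (φ : T →+* k) (D : Subring k) : pullbackRing φ D →+* D :=
  φ.restrict (pullbackRing φ D) D (fun _ hx => hx)

theorem pullbackProj_surjective (φ : T →+* k) (D : Subring k) (hφ : Function.Surjective φ) :
    Function.Surjective (pullbackProj φ D) := by
  intro d
  obtain ⟨t, ht⟩ := hφ d
  exact ⟨⟨t, by rw [Subring.mem_comap, ht]; exact d.2⟩, Subtype.ext ht⟩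

theorem pullback_conductor (φ : T →+* k) (D : Subring k) [h : Fact (RingHom.ker φ ≠ ⊥)] :
    ∃ c : T, c ≠ 0 ∧ ∀ t : T, c * t ∈ pullbackRing φ D := by
  obtain ⟨c, hc, hc0⟩ := Submodule.exists_mem_ne_zero_of_ne_bot h.out
  refine ⟨c, hc0, fun t => ?_⟩
  rw [Subring.mem_comap, map_mul, (RingHom.mem_ker).1 hc, zero_mul]
  exact D.zero_mem

/-- If the kernel of `φ` is nonzero, `R = φ⁻¹(D)` has the same quotient field as `T`. -/
instance pullback_isFractionRing (φ : T →+* k) (D : Subring k) [Fact (RingHom.ker φ ≠ ⊥)]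
    {K : Type*} [Field K] [Algebra T K] [IsFractionRing T K] :
    IsFractionRing (pullbackRing φ D) K := by
  obtain ⟨c, hc, h⟩ := pullback_conductor φ D
  have hinj : Function.Injective (algebraMap (pullbackRing φ D) K) := fun a b hab =>
    Subtype.ext (IsFractionRing.injective T K hab)
  have : FaithfulSMul (pullbackRing φ D) K := (faithfulSMul_iff_algebraMap_injective _ _).2 hinj
  refine IsFractionRing.of_field _ _ (fun z => ?_)
  obtain ⟨a, b, hb, rfl⟩ := IsFractionRing.div_surjective (A := T) z
  have hb0 : algebraMap T K b ≠ 0 := by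
    simpa using nonZeroDivisors.ne_zero hb
  have hc0 : algebraMap T K c ≠ 0 := by simpa using hc
  refine ⟨⟨c * a, h a⟩, ⟨c * b, h b⟩, ?_⟩
  change _ = algebraMap T K (c * a) / algebraMap T K (c * b)
  rw [map_mul, map_mul, mul_div_mul_left _ _ hc0]

/-- The group homomorphism `U(T) → k^• / U(D)`, `u ↦ φ(u) U(D)`. -/
def unitsQuotientMap (φ : T →+* k) (D : Subring k) :
    Tˣ →* kˣ ⧸ (Units.map (D.subtype : D →* k)).range :=
  (QuotientGroup.mk' _).comp (Units.map (φ : T →* k))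

/-- The preimage `φ⁻¹(J) = {t ∈ T | φ(t) ∈ J}` of a fractional ideal `J` of `D` (a subset of `k`),
as a fractional ideal of the pullback `R = φ⁻¹(D)` (a subset of the quotient field `K` of `T`). -/
def preimageIdeal (φ : T →+* k) (hφ : Function.Surjective φ) (D : Subring k)
    (K : Type*) [Field K] [Algebra T K] (J : FractionalIdeal D⁰ k) :
    FractionalIdeal (pullbackRing φ D)⁰ K :=
  ⟨{ carrier := {x | ∃ t : T, φ t ∈ J ∧ algebraMap T K t = x}
     zero_mem' := ⟨0, by rw [map_zero]; exact J.zero_mem, map_zero _⟩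
     add_mem' := by
      rintro _ _ ⟨a, ha, rfl⟩ ⟨b, hb, rfl⟩
      exact ⟨a + b, by rw [map_add]; exact Submodule.add_mem (J : Submodule D k) ha hb,
        map_add _ _ _⟩
     smul_mem' := by
      rintro r _ ⟨a, ha, rfl⟩
      refine ⟨r * a, ?_, ?_⟩
      · rw [map_mul]
        exact Submodule.smul_mem (J : Submodule D k) (pullbackProj φ D r) ha
      · rw [map_mul, Algebra.smul_def]
        rfl }, by
    obtain ⟨d, hd, hJ⟩ := J.isFractional
    obtain ⟨r, rfl⟩ := pullbackProj_surjective φ D hφ d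
    refine ⟨r, ?_, ?_⟩
    · rw [mem_nonZeroDivisors_iff_ne_zero]
      rintro rfl
      rw [map_zero] at hd
      exact nonZeroDivisors.ne_zero hd rfl
    · rintro _ ⟨a, ha, rfl⟩
      obtain ⟨e, he⟩ := hJ _ ha
      refine ⟨⟨r * a, ?_⟩, ?_⟩
      · rw [Subring.mem_comap, map_mul]
        have h1 : φ r * φ a = (e : k) := he.symm
        rw [h1]
        exact e.2
      · change algebraMap T K (r * a) = (r : T) • algebraMap T K a
        rw [map_mul, Algebra.smul_def]⟩

end Pullback

set_option linter.unusedSectionVars false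

/-! Write M for the kernel of φ. The proof rests on two facts about M. First, M^* = M. Since M is a
T-module, so is M^*, and it lies in R; an element of it outside M would force φ(T) = k into D
(`map_preimageIdeal_zero_le`). Hence a *-invertible H cannot satisfy HH⁻¹ ⊆ M, and up to a principal
factor H is an integral ideal I ⊄ M. Such an I has an element invertible modulo M. Second, HT·M ⊆ H,
because M is an ideal of T (`mul_mem_of_mem_extendIdeal`). So I and IT differ only modulo M, and
splitting an element t as ta + t(1 - a), with a ∈ IT and φ(a) = 1, transfers closedness between R
and T.

These give β: I^* ⊆ (IT)^{(*)_T}, and IT is closed if I is (`map_coeIdeal_le_extend`,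
`extend_extendIdeal_coeIdeal`). For γ, the relation between (φ⁻¹(J))^* and J^{*_φ} gives φ(I^*) ⊆
φ(I)^{*_φ}. The map is built with the closure *_φ in place of v_D; the two agree because the closure
is *_φ-invertible, hence divisorial (`inv_inv_eq_map`).

The hypothesis on units says that each nonzero y in k is, up to a unit of D, the image of a unit u
of T. Then φ⁻¹(yD) = uR, so φ⁻¹ is multiplicative on nonzero ideals, commutes with the closures and
preserves principal ideals, which gives α. From φ(φ⁻¹(J)) = J one gets γ∘α = id, hence α is
injective. For exactness in the middle, φ⁻¹(J) contains a unit of T, so φ⁻¹(J)T = T. Conversely, if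
HT is principal, the unit hypothesis lets one rescale H to an integral I with IT = T; then M = IT·M
⊆ I, and I = φ⁻¹(φ(I)). For surjectivity of β, a *_T-invertible ideal E ⊄ M of T is extended from E
∩ R, and the unit hypothesis makes E ∩ R *-invertible (`map_contract_mul`). -/

namespace StarOperation

/-! ### Star-invertible ideals and their classes over an arbitrary domain. -/

section General

variable {A K : Type*} [CommRing A] [IsDomain A] [Field K] [Algebra A K] [IsFractionRing A K]

theorem spanSingleton_inv_mul_cancel_left {x : K} (hx : x ≠ 0) (I : FractionalIdeal A⁰ K) :
    FractionalIdeal.spanSingleton A⁰ x⁻¹ * (FractionalIdeal.spanSingleton A⁰ x * I) = I := by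
  rw [← mul_assoc, FractionalIdeal.spanSingleton_mul_spanSingleton, inv_mul_cancel₀ hx,
    FractionalIdeal.spanSingleton_one, one_mul]

theorem spanSingleton_mul_injective {x : K} (hx : x ≠ 0) :
    Function.Injective (FractionalIdeal.spanSingleton A⁰ x * ·) := fun I J h => by
  rw [← spanSingleton_inv_mul_cancel_left hx I, ← spanSingleton_inv_mul_cancel_left hx J]
  exact congrArg _ h

theorem mem_one_of_le_one {I : FractionalIdeal A⁰ K} (hI : I ≤ 1) {x : K} (hx : x ∈ I) :
    ∃ a : A, algebraMap A K a = x :=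
  (FractionalIdeal.mem_one_iff _).1 (hI hx)

variable (s : StarOperation A K)

theorem map_le_one {I : FractionalIdeal A⁰ K} (hI : I ≤ 1) : s I ≤ 1 := by
  have := s.mono hI
  rwa [s.map_one] at this

theorem coe_idealClosure (I : Ideal A) :
    ((s.idealClosure I : Ideal A) : FractionalIdeal A⁰ K) = s I := by
  apply le_antisymm
  · intro x hx
    obtain ⟨b, hb, rfl⟩ := (FractionalIdeal.mem_coeIdeal _).1 hx
    exact hb
  · intro x hx
    obtain ⟨a, rfl⟩ := mem_one_of_le_one (s.map_le_one FractionalIdeal.coeIdeal_le_one) hx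
    exact FractionalIdeal.mem_coeIdeal_of_mem _ hx

variable {s} in
theorem IsInvertibleStarIdeal.smul {I : FractionalIdeal A⁰ K} (hI : s.IsInvertibleStarIdeal I)
    {x : K} (hx : x ≠ 0) :
    s.IsInvertibleStarIdeal (FractionalIdeal.spanSingleton A⁰ x * I) := by
  have h := (s.isInvertibleStarIdeal_spanSingleton (Units.mk0 x hx)).mul hI
  rwa [s.map_smul, hI.2.1] at h

theorem isInvertibleStarIdeal_smul_iff {I : FractionalIdeal A⁰ K} {x : K} (hx : x ≠ 0) :
    s.IsInvertibleStarIdeal (FractionalIdeal.spanSingleton A⁰ x * I) ↔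
      s.IsInvertibleStarIdeal I := by
  refine ⟨fun h => ?_, fun h => h.smul hx⟩
  have := h.smul (inv_ne_zero hx)
  rwa [spanSingleton_inv_mul_cancel_left hx] at this

/-- Replacing J by x⁻¹J reduces to closure A. This form is needed because products of integral
ideals normally close up to a principal ideal other than A. -/
theorem isInvertibleStarIdeal_map {I J : FractionalIdeal A⁰ K} {x : K} (hx : x ≠ 0)
    (h : s (I * J) = FractionalIdeal.spanSingleton A⁰ x) : s.IsInvertibleStarIdeal (s I) := by
  refine s.isInvertibleStarIdeal_of_map_mul
    (J := FractionalIdeal.spanSingleton A⁰ x⁻¹ * J) (s.idem _) ?_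
  rw [s.map_mul_left, mul_left_comm, s.map_smul, h,
    FractionalIdeal.spanSingleton_mul_spanSingleton, inv_mul_cancel₀ hx,
    FractionalIdeal.spanSingleton_one]

-- Inversion in the group Inv^s(A) is I ↦ I⁻¹, so the group identity `inv_inv` says that
-- star-invertible ideals are divisorial.
variable {s} in
theorem IsInvertibleStarIdeal.inv_inv {I : FractionalIdeal A⁰ K}
    (hI : s.IsInvertibleStarIdeal I) : (I⁻¹)⁻¹ = I :=
  congrArg Subtype.val (_root_.inv_inv (show s.InvIdeals from ⟨I, hI⟩))

theorem inv_map {I : FractionalIdeal A⁰ K} (hI : I ≠ 0) : (s I)⁻¹ = I⁻¹ := by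
  have h0 : s I ≠ 0 := fun h =>
    hI (le_antisymm ((s.le_map I).trans h.le) (FractionalIdeal.zero_le _))
  apply le_antisymm
  · exact FractionalIdeal.inv_anti_mono hI h0 (s.le_map I)
  · rw [FractionalIdeal.inv_eq (I := s I), FractionalIdeal.le_div_iff_mul_le h0, mul_comm]
    exact (s.map_mul_le I _).trans (s.map_le_one FractionalIdeal.mul_one_div_le_one)

/-- This lets the v-closure in the description of γ be exchanged for the star closure: I and I^s
have the same inverse, and I^s is divisorial. -/
theorem inv_inv_eq_map {I : FractionalIdeal A⁰ K} (h : s.IsInvertibleStarIdeal (s I)) :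
    (I⁻¹)⁻¹ = s I := by
  have hI : I ≠ 0 := by
    rintro rfl
    exact h.1 s.map_zero'
  rw [← s.inv_map hI, h.inv_inv]

theorem cls_congr {I J : FractionalIdeal A⁰ K} {hI : s.IsInvertibleStarIdeal I} (h : I = J)
    {hJ : s.IsInvertibleStarIdeal J} : s.cls I hI = s.cls J hJ := by
  subst h
  rfl

theorem cls_mul {I J : FractionalIdeal A⁰ K} (hI : s.IsInvertibleStarIdeal I)
    (hJ : s.IsInvertibleStarIdeal J) :
    s.cls I hI * s.cls J hJ = s.cls (s (I * J)) (hI.mul hJ) := rfl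

theorem cls_spanSingleton {x : K} (hx : x ≠ 0)
    (h : s.IsInvertibleStarIdeal (FractionalIdeal.spanSingleton A⁰ x)) :
    s.cls (FractionalIdeal.spanSingleton A⁰ x) h = 1 :=
  (QuotientGroup.eq_one_iff _).2 ⟨Units.mk0 x hx, rfl⟩

theorem exists_of_cls_eq_one {I : FractionalIdeal A⁰ K} {hI : s.IsInvertibleStarIdeal I}
    (h : s.cls I hI = 1) : ∃ x : K, x ≠ 0 ∧ I = FractionalIdeal.spanSingleton A⁰ x := by
  obtain ⟨x, hx⟩ := (QuotientGroup.eq_one_iff _).1 h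
  exact ⟨x, x.ne_zero, (congrArg Subtype.val hx).symm⟩

theorem cls_smul {I : FractionalIdeal A⁰ K} (hI : s.IsInvertibleStarIdeal I) {x : K} (hx : x ≠ 0)
    (h : s.IsInvertibleStarIdeal (FractionalIdeal.spanSingleton A⁰ x * I)) :
    s.cls (FractionalIdeal.spanSingleton A⁰ x * I) h = s.cls I hI := by
  have h1 : s.IsInvertibleStarIdeal (FractionalIdeal.spanSingleton A⁰ x) :=
    s.isInvertibleStarIdeal_spanSingleton (Units.mk0 x hx)
  rw [← one_mul (s.cls I hI), ← s.cls_spanSingleton hx h1, s.cls_mul]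
  refine s.cls_congr ?_
  rw [s.map_smul, hI.2.1]

variable {s} in
/-- If `P` is a proper ideal with `P^s = P`, every `s`-invertible ideal is a multiple of an integral
ideal that is not contained in `P`. -/
theorem IsInvertibleStarIdeal.exists_eq_smul {I : FractionalIdeal A⁰ K}
    (hI : s.IsInvertibleStarIdeal I) {P : Ideal A} (hP : P ≠ ⊤)
    (hsP : s (P : FractionalIdeal A⁰ K) ≤ P) :
    ∃ (z : K) (I' : Ideal A), z ≠ 0 ∧ ¬ I' ≤ P ∧
      I = FractionalIdeal.spanSingleton A⁰ z * (I' : FractionalIdeal A⁰ K) := by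
  -- Otherwise A = (I I⁻¹)^s ⊆ P^s ⊆ P. A product xy outside P, with x ∈ I and y ∈ I⁻¹, then shows
  -- that yI is integral and not contained in P.
  have h1 : ¬ I * I⁻¹ ≤ (P : FractionalIdeal A⁰ K) := by
    intro h
    have h2 := (s.mono h).trans hsP
    rw [hI.2.2, ← FractionalIdeal.coeIdeal_top, FractionalIdeal.coeIdeal_le_coeIdeal] at h2
    exact hP (top_le_iff.1 h2)
  rw [FractionalIdeal.mul_le] at h1
  push Not at h1
  obtain ⟨x, hx, y, hy, hxy⟩ := h1
  have hy0 : y ≠ 0 := by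
    rintro rfl
    rw [mul_zero] at hxy
    exact hxy (FractionalIdeal.zero_mem _)
  have hle : FractionalIdeal.spanSingleton A⁰ y * I ≤ 1 := by
    rw [FractionalIdeal.spanSingleton_mul_le_iff]
    exact (FractionalIdeal.mem_inv_iff hI.1).1 hy
  obtain ⟨I', hI'⟩ := FractionalIdeal.le_one_iff_exists_coeIdeal.1 hle
  refine ⟨y⁻¹, I', inv_ne_zero hy0, fun h => hxy ?_, ?_⟩
  · refine (FractionalIdeal.coeIdeal_le_coeIdeal K).2 h ?_
    rw [hI', mul_comm x y]
    exact FractionalIdeal.mul_mem_mul (FractionalIdeal.mem_spanSingleton_self _ _) hx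
  · rw [hI', spanSingleton_inv_mul_cancel_left hy0]

end General

/-! ### Extension of fractional ideals from R to T. -/

section Extend

variable {T K : Type*} [CommRing T] [IsDomain T] [Field K] [Algebra T K] [IsFractionRing T K]
  {R : Subring T}

theorem mem_extendIdeal {H : FractionalIdeal R⁰ K} {x : K} (hx : x ∈ H) : x ∈ extendIdeal H :=
  Submodule.subset_span hx

theorem extendIdeal_le {H : FractionalIdeal R⁰ K} {E : FractionalIdeal T⁰ K} :
    extendIdeal H ≤ E ↔ ∀ x ∈ H, x ∈ E :=
  Submodule.span_le (R := T) (p := (E : Submodule T K)) (s := (H : Set K))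

theorem extendIdeal_mono {H J : FractionalIdeal R⁰ K} (h : H ≤ J) :
    extendIdeal H ≤ extendIdeal J :=
  extendIdeal_le.2 fun _ hx => mem_extendIdeal (h hx)

theorem extendIdeal_mul (H J : FractionalIdeal R⁰ K) :
    extendIdeal (H * J) = extendIdeal H * extendIdeal J := by
  rw [← FractionalIdeal.coeToSubmodule_inj, FractionalIdeal.coe_mul]
  change Submodule.span T ((H * J : FractionalIdeal R⁰ K) : Set K) =
    Submodule.span T (H : Set K) * Submodule.span T (J : Set K)
  rw [Submodule.span_mul_span]
  apply le_antisymm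
  · rw [Submodule.span_le]
    intro x hx
    refine FractionalIdeal.mul_induction_on hx (fun i hi j hj => ?_) (fun a b ha hb => ?_)
    · exact Submodule.subset_span (Set.mul_mem_mul hi hj)
    · exact Submodule.add_mem _ ha hb
  · refine Submodule.span_mono ?_
    rintro _ ⟨i, hi, j, hj, rfl⟩
    exact FractionalIdeal.mul_mem_mul hi hj

theorem extendIdeal_spanSingleton [IsFractionRing R K] (x : K) :
    extendIdeal (FractionalIdeal.spanSingleton R⁰ x) = FractionalIdeal.spanSingleton T⁰ x := by
  apply le_antisymm
  · rw [extendIdeal_le]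
    intro y hy
    obtain ⟨r, rfl⟩ := (FractionalIdeal.mem_spanSingleton _).1 hy
    exact (FractionalIdeal.mem_spanSingleton _).2 ⟨r, rfl⟩
  · rw [FractionalIdeal.spanSingleton_le_iff_mem]
    exact mem_extendIdeal (FractionalIdeal.mem_spanSingleton_self _ _)

theorem extendIdeal_coeIdeal_le_one (I : Ideal R) :
    extendIdeal (I : FractionalIdeal R⁰ K) ≤ 1 := by
  rw [extendIdeal_le]
  intro x hx
  obtain ⟨r, _, rfl⟩ := (FractionalIdeal.mem_coeIdeal _).1 hx
  exact (FractionalIdeal.mem_one_iff _).2 ⟨r, rfl⟩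

theorem le_restrictIdeal_extendIdeal (hR : ∃ c : T, c ≠ 0 ∧ ∀ t : T, c * t ∈ R)
    (H : FractionalIdeal R⁰ K) : H ≤ restrictIdeal hR (extendIdeal H) :=
  fun _ hx => mem_extendIdeal hx

end Extend

end StarOperation

/-! ### The ideal M of the pullback and its interaction with the closures on R and T. -/

section Pullback

variable {T K k : Type*} [CommRing T] [IsDomain T] [Field K] [Algebra T K] [IsFractionRing T K]
  [Field k] (φ : T →+* k) (hφ : Function.Surjective φ) [Fact (RingHom.ker φ ≠ ⊥)] (D : Subring k)

open StarOperation

theorem mem_preimageIdeal {J : FractionalIdeal D⁰ k} {x : K} :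
    x ∈ preimageIdeal φ hφ D K J ↔ ∃ t : T, φ t ∈ J ∧ algebraMap T K t = x := Iff.rfl

theorem algebraMap_mem_preimageIdeal {J : FractionalIdeal D⁰ k} {t : T} :
    algebraMap T K t ∈ preimageIdeal φ hφ D K J ↔ φ t ∈ J := by
  constructor
  · rintro ⟨t', ht', h⟩
    rwa [← IsFractionRing.injective T K h]
  · exact fun h => ⟨t, h, rfl⟩

theorem preimageIdeal_mono {J J' : FractionalIdeal D⁰ k} (h : J ≤ J') :
    preimageIdeal φ hφ D K J ≤ preimageIdeal φ hφ D K J' := by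
  rintro _ ⟨t, ht, rfl⟩
  exact ⟨t, h ht, rfl⟩

theorem algebraMap_mem_preimageIdeal_of_eq_zero {J : FractionalIdeal D⁰ k} {t : T}
    (h : φ t = 0) : algebraMap T K t ∈ preimageIdeal φ hφ D K J :=
  ⟨t, by rw [h]; exact FractionalIdeal.zero_mem _, rfl⟩

theorem mem_preimageIdeal_zero {x : K} :
    x ∈ preimageIdeal φ hφ D K 0 ↔ ∃ t : T, φ t = 0 ∧ algebraMap T K t = x := by
  simp only [mem_preimageIdeal, FractionalIdeal.mem_zero_iff]

/-- M plays three roles: kernel of R → D, kernel of T → k, and φ⁻¹(0) inside K. The last one,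
`preimageIdeal φ hφ D K 0`, serves as the common form. -/
theorem coeIdeal_ker_pullbackProj :
    ((RingHom.ker (pullbackProj φ D) : Ideal (pullbackRing φ D)) :
      FractionalIdeal (pullbackRing φ D)⁰ K) = preimageIdeal φ hφ D K 0 := by
  ext x
  rw [FractionalIdeal.mem_coeIdeal, mem_preimageIdeal_zero]
  constructor
  · rintro ⟨r, hr, rfl⟩
    exact ⟨r, congrArg Subtype.val hr, rfl⟩
  · rintro ⟨t, ht, rfl⟩
    exact ⟨⟨t, by rw [Subring.mem_comap, ht]; exact D.zero_mem⟩, Subtype.ext ht, rfl⟩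

theorem restrictIdeal_ker :
    restrictIdeal (pullback_conductor φ D)
      ((RingHom.ker φ : Ideal T) : FractionalIdeal T⁰ K) = preimageIdeal φ hφ D K 0 := by
  ext x
  rw [mem_restrictIdeal, FractionalIdeal.mem_coeIdeal, mem_preimageIdeal_zero]
  rfl

theorem exists_algebraMap_of_mem_one {x : K}
    (hx : x ∈ (1 : FractionalIdeal (pullbackRing φ D)⁰ K)) :
    ∃ t : T, φ t ∈ D ∧ algebraMap T K t = x := by
  obtain ⟨r, rfl⟩ := (FractionalIdeal.mem_one_iff _).1 hx
  exact ⟨r, r.2, rfl⟩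

theorem not_le_ker_iff {I : Ideal (pullbackRing φ D)} :
    ¬ I ≤ RingHom.ker (pullbackProj φ D) ↔ ∃ t : pullbackRing φ D, t ∈ I ∧ φ t ≠ 0 := by
  rw [SetLike.not_le_iff_exists]
  refine exists_congr fun t => and_congr_right fun _ => not_congr ?_
  exact ⟨fun h => congrArg Subtype.val h, fun h => Subtype.ext h⟩

include hφ in
theorem exists_map_eq_one {E : FractionalIdeal T⁰ K} {t : T} (ht : algebraMap T K t ∈ E)
    (h0 : φ t ≠ 0) : ∃ a : T, algebraMap T K a ∈ E ∧ φ a = 1 := by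
  obtain ⟨b, hb⟩ := hφ (φ t)⁻¹
  refine ⟨b * t, ?_, by rw [map_mul, hb, inv_mul_cancel₀ h0]⟩
  have := Submodule.smul_mem (E : Submodule T K) b ht
  rwa [Algebra.smul_def, ← map_mul] at this

include hφ in
theorem exists_mem_extendIdeal_map_eq_one {I : Ideal (pullbackRing φ D)}
    (hI : ¬ I ≤ RingHom.ker (pullbackProj φ D)) :
    ∃ a : T, algebraMap T K a ∈ extendIdeal (I : FractionalIdeal (pullbackRing φ D)⁰ K) ∧
      φ a = 1 := by
  obtain ⟨t, ht, h0⟩ := (not_le_ker_iff φ D).1 hI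
  exact exists_map_eq_one φ hφ (mem_extendIdeal (FractionalIdeal.mem_coeIdeal_of_mem _ ht)) h0

/-- An element of `K` that is integral at `M` and maps `M` into `T` lies in `T`. -/
theorem exists_algebraMap_eq {x : K} {a : T} (ha : φ a ≠ 0) (hφ : Function.Surjective φ)
    (hxa : ∃ t, algebraMap T K t = x * algebraMap T K a)
    (hx : ∀ m, φ m = 0 → ∃ t, algebraMap T K t = x * algebraMap T K m) :
    ∃ t, algebraMap T K t = x := by
  -- b inverts a modulo M, so x = (xa)b + x(1 - ab) with 1 - ab ∈ M.
  obtain ⟨b, hb⟩ := hφ (φ a)⁻¹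
  obtain ⟨t, ht⟩ := hxa
  obtain ⟨t', ht'⟩ := hx (1 - a * b) (by simp [hb, ha])
  refine ⟨t * b + t', ?_⟩
  rw [map_add, map_mul, ht, ht', map_sub, map_mul, _root_.map_one]
  ring

/-- HT·M = H·TM = HM, since M absorbs multiplication by T. -/
theorem mul_mem_mul_preimageIdeal_zero {H : FractionalIdeal (pullbackRing φ D)⁰ K} {x : K}
    (hx : x ∈ extendIdeal H) {m : T} (hm : φ m = 0) :
    x * algebraMap T K m ∈ H * preimageIdeal φ hφ D K 0 := by
  change x ∈ Submodule.span T (H : Set K) at hx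
  induction hx using Submodule.span_induction generalizing m with
  | mem x hx =>
    exact FractionalIdeal.mul_mem_mul hx (algebraMap_mem_preimageIdeal_of_eq_zero φ hφ D hm)
  | zero =>
    rw [zero_mul]
    exact FractionalIdeal.zero_mem _
  | add x y _ _ hx hy =>
    rw [add_mul]
    exact Submodule.add_mem (H * preimageIdeal φ hφ D K 0 : FractionalIdeal _ K).1 (hx hm) (hy hm)
  | smul t x _ hx =>
    have := hx (m := t * m) (by rw [map_mul, hm, mul_zero])
    rwa [map_mul, mul_left_comm, ← mul_assoc, ← Algebra.smul_def] at this

theorem preimageIdeal_zero_le_one : preimageIdeal φ hφ D K 0 ≤ 1 := by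
  rw [← coeIdeal_ker_pullbackProj φ hφ D]
  exact FractionalIdeal.coeIdeal_le_one

include hφ in
theorem mul_mem_of_mem_extendIdeal {H : FractionalIdeal (pullbackRing φ D)⁰ K} {x : K}
    (hx : x ∈ extendIdeal H) {m : T} (hm : φ m = 0) : x * algebraMap T K m ∈ H := by
  have h := mul_le_mul_right (preimageIdeal_zero_le_one (K := K) φ hφ D) H
  rw [mul_one] at h
  exact h (mul_mem_mul_preimageIdeal_zero φ hφ D hx hm)

variable (star : StarOperation (pullbackRing φ D) K)

-- M^* is a T-module contained in R. If it contained t with φ(t) ≠ 0, then Tt ⊆ R, and applying φ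
-- would give k = φ(T)φ(t) ⊆ D.
include hφ in
theorem map_preimageIdeal_zero_le (hD : D ≠ ⊤) :
    star (preimageIdeal φ hφ D K 0) ≤ preimageIdeal φ hφ D K 0 := by
  intro x hx
  obtain ⟨t, htD, rfl⟩ := exists_algebraMap_of_mem_one φ D
    (star.map_le_one (preimageIdeal_zero_le_one φ hφ D) hx)
  rw [algebraMap_mem_preimageIdeal, FractionalIdeal.mem_zero_iff]
  by_contra h0
  refine hD (eq_top_iff.2 fun y _ => ?_)
  obtain ⟨b, hb⟩ := hφ (y * (φ t)⁻¹)
  rw [← restrictIdeal_ker φ hφ D] at hx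
  have h1 := star.smul_mem_restrict _ _ b hx
  rw [restrictIdeal_ker φ hφ D, Algebra.smul_def, ← map_mul] at h1
  obtain ⟨t', ht', h2⟩ := exists_algebraMap_of_mem_one φ D
    (star.map_le_one (preimageIdeal_zero_le_one φ hφ D) h1)
  rwa [IsFractionRing.injective T K h2, map_mul, hb, inv_mul_cancel_right₀ h0] at ht'

include hφ in
/-- The extension of `I^*` to `T` is contained in the closure of `IT`, for `I` an ideal of `R`
that is not contained in `M`. -/
theorem map_coeIdeal_le_extend (hD : D ≠ ⊤) {I : Ideal (pullbackRing φ D)}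
    (hI : ¬ I ≤ RingHom.ker (pullbackProj φ D)) {x : K}
    (hx : x ∈ star (I : FractionalIdeal (pullbackRing φ D)⁰ K)) :
    x ∈ star.extend (pullback_conductor φ D)
      (extendIdeal (I : FractionalIdeal (pullbackRing φ D)⁰ K)) := by
  refine ⟨star.mono (le_restrictIdeal_extendIdeal _ _) hx, ?_⟩
  obtain ⟨r, hr, hr0⟩ := (not_le_ker_iff φ D).1 hI
  have hrI : algebraMap T K r ∈ (I : FractionalIdeal (pullbackRing φ D)⁰ K) :=
    FractionalIdeal.mem_coeIdeal_of_mem _ hr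
  have hne : extendIdeal (I : FractionalIdeal (pullbackRing φ D)⁰ K) ≠ 0 := by
    intro h
    have h1 := mem_extendIdeal hrI
    rw [h, FractionalIdeal.mem_zero_iff] at h1
    refine hr0 ?_
    rw [IsFractionRing.injective T K (h1.trans (map_zero _).symm), map_zero]
  rw [FractionalIdeal.mem_inv_iff (inv_ne_zero_of hne)]
  intro y hy
  rw [FractionalIdeal.mem_inv_iff hne] at hy
  rw [FractionalIdeal.mem_one_iff]
  -- It remains to see xy ∈ T. Since r ∈ I is invertible modulo M, it suffices that xyr = x·(yr) ∈ T
  -- and that xyM ⊆ T.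
  refine exists_algebraMap_eq φ hr0 hφ ?_ ?_
  · obtain ⟨x', -, rfl⟩ := exists_algebraMap_of_mem_one φ D
      (star.map_le_one FractionalIdeal.coeIdeal_le_one hx)
    obtain ⟨y', hy'⟩ := (FractionalIdeal.mem_one_iff _).1 (hy _ (mem_extendIdeal hrI))
    exact ⟨x' * y', by rw [map_mul, hy', mul_assoc]⟩
  · intro m hm
    -- From yI ⊆ T one gets ymI ⊆ M for m ∈ M; taking closures and using M^* = M gives ymx ∈ M.
    have h1 : FractionalIdeal.spanSingleton (pullbackRing φ D)⁰ (y * algebraMap T K m) * I ≤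
        preimageIdeal φ hφ D K 0 := by
      rw [FractionalIdeal.spanSingleton_mul_le_iff]
      intro z hz
      obtain ⟨t, ht⟩ := (FractionalIdeal.mem_one_iff _).1 (hy _ (mem_extendIdeal hz))
      rw [mul_right_comm, ← ht, ← map_mul]
      exact algebraMap_mem_preimageIdeal_of_eq_zero φ hφ D (by rw [map_mul, hm, mul_zero])
    have h2 := (star.mono h1).trans (map_preimageIdeal_zero_le φ hφ D star hD)
    rw [star.map_smul] at h2
    obtain ⟨t, -, ht⟩ := h2 (FractionalIdeal.mul_mem_mul
      (FractionalIdeal.mem_spanSingleton_self _ _) hx)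
    exact ⟨t, by rw [ht]; ring⟩

include hφ in
/-- `IT` is closed if `I` is a closed ideal of `R` that is not contained in `M`. -/
theorem extend_extendIdeal_coeIdeal {I : Ideal (pullbackRing φ D)}
    (hI : ¬ I ≤ RingHom.ker (pullbackProj φ D))
    (hs : star (I : FractionalIdeal (pullbackRing φ D)⁰ K) = I) :
    star.extend (pullback_conductor φ D)
      (extendIdeal (I : FractionalIdeal (pullbackRing φ D)⁰ K)) =
      extendIdeal (I : FractionalIdeal (pullbackRing φ D)⁰ K) := by
  refine le_antisymm (fun x hx => ?_) (StarOperation.le_map _ _)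
  obtain ⟨t, rfl⟩ := (FractionalIdeal.mem_one_iff _).1
    (StarOperation.map_le_one _ (extendIdeal_coeIdeal_le_one I) hx)
  -- Split t = ta + t(1 - a). The first term is in IT; the second lies in (IT)^*·M ⊆ (IT·M)^* ⊆ I^*
  -- = I.
  obtain ⟨a, ha, ha1⟩ := exists_mem_extendIdeal_map_eq_one (K := K) φ hφ D hI
  have hm : φ (1 - a) = 0 := by rw [map_sub, _root_.map_one, ha1, sub_self]
  have h1 := Submodule.smul_mem
    (extendIdeal (I : FractionalIdeal (pullbackRing φ D)⁰ K) : Submodule T K) t ha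
  have h2 : algebraMap T K t * algebraMap T K (1 - a) ∈
      star (I : FractionalIdeal (pullbackRing φ D)⁰ K) := by
    have h3 : restrictIdeal (pullback_conductor φ D)
        (extendIdeal (I : FractionalIdeal (pullbackRing φ D)⁰ K)) * preimageIdeal φ hφ D K 0 ≤
        I := by
      rw [FractionalIdeal.mul_le]
      rintro x hx y hy
      obtain ⟨m, hm', rfl⟩ := (mem_preimageIdeal_zero φ hφ D).1 hy
      exact mul_mem_of_mem_extendIdeal φ hφ D hx hm'
    exact ((star.map_mul_le _ _).trans (star.mono h3)) (FractionalIdeal.mul_mem_mul hx.1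
      ((mem_preimageIdeal_zero φ hφ D).2 ⟨_, hm, rfl⟩))
  rw [hs] at h2
  have h4 := Submodule.add_mem
    (extendIdeal (I : FractionalIdeal (pullbackRing φ D)⁰ K) : Submodule T K)
    h1 (mem_extendIdeal h2)
  rwa [Algebra.smul_def, ← mul_add, ← map_add, add_sub_cancel, _root_.map_one, mul_one] at h4

end Pullback

/-! ### The homomorphism β. -/

section Extension

variable {T K k : Type*} [CommRing T] [IsDomain T] [Field K] [Algebra T K] [IsFractionRing T K]
  [Field k] (φ : T →+* k) (hφ : Function.Surjective φ) [Fact (RingHom.ker φ ≠ ⊥)] (D : Subring k)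
  (hD : D ≠ ⊤) (star : StarOperation (pullbackRing φ D) K)

open StarOperation

/-- The star operation `(*)_T` on `T`. -/
noncomputable abbrev pullbackExtend : StarOperation T K :=
  star.extend (pullback_conductor φ D)

theorem extendIdeal_smul (z : K) (I : FractionalIdeal (pullbackRing φ D)⁰ K) :
    extendIdeal (FractionalIdeal.spanSingleton _ z * I) =
      FractionalIdeal.spanSingleton T⁰ z * extendIdeal I := by
  rw [extendIdeal_mul, extendIdeal_spanSingleton]

include hφ hD in
theorem exists_eq_smul_coeIdeal {H : FractionalIdeal (pullbackRing φ D)⁰ K}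
    (hH : star.IsInvertibleStarIdeal H) :
    ∃ (z : K) (H' : Ideal (pullbackRing φ D)), z ≠ 0 ∧
      ¬ H' ≤ RingHom.ker (pullbackProj φ D) ∧
      H = FractionalIdeal.spanSingleton _ z * (H' : FractionalIdeal (pullbackRing φ D)⁰ K) := by
  refine hH.exists_eq_smul (RingHom.ker_ne_top _) ?_
  rw [coeIdeal_ker_pullbackProj φ hφ D]
  exact map_preimageIdeal_zero_le φ hφ D star hD

theorem not_mul_le_ker {I J : Ideal (pullbackRing φ D)}
    (hI : ¬ I ≤ RingHom.ker (pullbackProj φ D)) (hJ : ¬ J ≤ RingHom.ker (pullbackProj φ D)) :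
    ¬ I * J ≤ RingHom.ker (pullbackProj φ D) := fun h =>
  ((RingHom.ker_isPrime (pullbackProj φ D)).mul_le.1 h).elim hI hJ

include hφ hD in
theorem exists_mul_eq_smul_coeIdeal {H J : FractionalIdeal (pullbackRing φ D)⁰ K}
    (hH : star.IsInvertibleStarIdeal H) (hJ : star.IsInvertibleStarIdeal J) :
    ∃ (z : K) (I : Ideal (pullbackRing φ D)), z ≠ 0 ∧
      ¬ I ≤ RingHom.ker (pullbackProj φ D) ∧
      H * J = FractionalIdeal.spanSingleton _ z *
        (I : FractionalIdeal (pullbackRing φ D)⁰ K) := by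
  obtain ⟨z, H', hz, hH', rfl⟩ := exists_eq_smul_coeIdeal φ hφ D hD star hH
  obtain ⟨w, J', hw, hJ', rfl⟩ := exists_eq_smul_coeIdeal φ hφ D hD star hJ
  refine ⟨z * w, H' * J', mul_ne_zero hz hw, not_mul_le_ker φ D hH' hJ', ?_⟩
  rw [mul_mul_mul_comm, FractionalIdeal.spanSingleton_mul_spanSingleton,
    FractionalIdeal.coeIdeal_mul]

-- Up to a scalar, HJ is an integral ideal I ⊄ M, and I^* lies in the closure of IT; enlarging I to
-- I^* therefore leaves the closure of the extension unchanged.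
include hφ hD in
theorem extend_extendIdeal_map {H J : FractionalIdeal (pullbackRing φ D)⁰ K}
    (hH : star.IsInvertibleStarIdeal H) (hJ : star.IsInvertibleStarIdeal J) :
    pullbackExtend φ D star (extendIdeal (star (H * J))) =
      pullbackExtend φ D star (extendIdeal (H * J)) := by
  obtain ⟨z, I, hz, hI, h⟩ := exists_mul_eq_smul_coeIdeal φ hφ D hD star hH hJ
  rw [h, star.map_smul, extendIdeal_smul, extendIdeal_smul, StarOperation.map_smul,
    StarOperation.map_smul]
  congr 1
  apply le_antisymm
  · rw [← StarOperation.idem _ (extendIdeal (I : FractionalIdeal (pullbackRing φ D)⁰ K))]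
    refine StarOperation.mono _ (extendIdeal_le.2 fun x hx => ?_)
    exact map_coeIdeal_le_extend φ hφ D star hD hI hx
  · exact StarOperation.mono _ (extendIdeal_mono (star.le_map _))

include hφ hD in
theorem extend_extendIdeal {H : FractionalIdeal (pullbackRing φ D)⁰ K}
    (hH : star.IsInvertibleStarIdeal H) :
    pullbackExtend φ D star (extendIdeal H) = extendIdeal H := by
  obtain ⟨z, I, hz, hI, rfl⟩ := exists_eq_smul_coeIdeal φ hφ D hD star hH
  rw [extendIdeal_smul, StarOperation.map_smul, extend_extendIdeal_coeIdeal φ hφ D star hI]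
  exact ((star.isInvertibleStarIdeal_smul_iff hz).1 hH).2.1

-- (HJ)^*T is already closed, so it is its own closure, which is that of HJT. This is the
-- multiplicativity of β.
include hφ hD in
theorem extendIdeal_map_mul {H J : FractionalIdeal (pullbackRing φ D)⁰ K}
    (hH : star.IsInvertibleStarIdeal H) (hJ : star.IsInvertibleStarIdeal J) :
    extendIdeal (star (H * J)) = pullbackExtend φ D star (extendIdeal H * extendIdeal J) := by
  rw [← extend_extendIdeal φ hφ D hD star (hH.mul hJ),
    extend_extendIdeal_map φ hφ D hD star hH hJ, extendIdeal_mul]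

theorem extendIdeal_one :
    extendIdeal (1 : FractionalIdeal (pullbackRing φ D)⁰ K) = 1 := by
  rw [← FractionalIdeal.spanSingleton_one, extendIdeal_spanSingleton,
    FractionalIdeal.spanSingleton_one]

include hφ hD in
theorem isInvertibleStarIdeal_extendIdeal {H : FractionalIdeal (pullbackRing φ D)⁰ K}
    (hH : star.IsInvertibleStarIdeal H) :
    (pullbackExtend φ D star).IsInvertibleStarIdeal (extendIdeal H) := by
  refine isInvertibleStarIdeal_of_map_mul _ (J := extendIdeal H⁻¹)
    (extend_extendIdeal φ hφ D hD star hH) ?_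
  rw [← extendIdeal_map_mul φ hφ D hD star hH hH.inv, hH.2.2, extendIdeal_one]

/-- The homomorphism `Inv^*(R) → Inv^{(*)_T}(T)`, `H ↦ HT`. -/
noncomputable def extendInv : star.InvIdeals →* (pullbackExtend φ D star).InvIdeals :=
  MonoidHom.mk' (fun H => ⟨extendIdeal H.1, isInvertibleStarIdeal_extendIdeal φ hφ D hD star H.2⟩)
    fun H J => Subtype.ext (extendIdeal_map_mul φ hφ D hD star H.2 J.2)

/-- The homomorphism `Cl^*(R) → Cl^{(*)_T}(T)`, `[H] ↦ [HT]`. -/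
noncomputable def extendCl : star.Cl →* (pullbackExtend φ D star).Cl :=
  QuotientGroup.map _ _ (extendInv φ hφ D hD star) <| by
    rintro _ ⟨x, rfl⟩
    exact ⟨x, Subtype.ext (extendIdeal_spanSingleton (R := pullbackRing φ D) (x : K)).symm⟩

theorem extendCl_cls {H : FractionalIdeal (pullbackRing φ D)⁰ K}
    (hH : star.IsInvertibleStarIdeal H) :
    extendCl φ hφ D hD star (star.cls H hH) = StarOperation.cls _ (extendIdeal H)
      (isInvertibleStarIdeal_extendIdeal φ hφ D hD star hH) := rfl

end Extension

/-! ### The projected star operation on D and the homomorphism γ. -/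

section Projection

variable {T K k : Type*} [CommRing T] [IsDomain T] [Field K] [Algebra T K] [IsFractionRing T K]
  [Field k] (φ : T →+* k) (hφ : Function.Surjective φ) [Fact (RingHom.ker φ ≠ ⊥)] (D : Subring k)
  [IsFractionRing D k] (hD : D ≠ ⊤) (star : StarOperation (pullbackRing φ D) K)

open StarOperation

/-- The star operation `*_φ` on `D`. -/
noncomputable abbrev pullbackStarProj : StarOperation D k :=
  star.proj (L := k) (pullbackProj φ D) (pullbackProj_surjective φ D hφ)

/-- This and the next inclusion compare φ⁻¹(J) with the ideal φ⁻¹(y⁻¹J ∩ D) of R entering the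
definition of *_φ. Multiplication by a lift of y goes one way, by a lift of y⁻¹ the other; lifts
need not be units of T, so only inclusions are claimed. -/
theorem smul_preimageIdeal_le {v : T} {y : k} (hv : φ v = y) (J : FractionalIdeal D⁰ k) :
    FractionalIdeal.spanSingleton _ (algebraMap T K v) *
      ((Ideal.comap (pullbackProj φ D) (scaledIdeal J y) : Ideal (pullbackRing φ D)) :
        FractionalIdeal (pullbackRing φ D)⁰ K) ≤ preimageIdeal φ hφ D K J := by
  rw [FractionalIdeal.spanSingleton_mul_le_iff]
  intro x hx
  obtain ⟨r, hr, rfl⟩ := (FractionalIdeal.mem_coeIdeal _).1 hx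
  refine ⟨v * r, ?_, map_mul _ _ _⟩
  rw [map_mul, hv]
  exact hr

theorem preimageIdeal_smul_le {v : T} {y : k} (hy : y ≠ 0) (hv : φ v = y⁻¹)
    {J : FractionalIdeal D⁰ k} (hJ : J ≤ FractionalIdeal.spanSingleton _ y) :
    FractionalIdeal.spanSingleton _ (algebraMap T K v) * preimageIdeal φ hφ D K J ≤
      ((Ideal.comap (pullbackProj φ D) (scaledIdeal J y) : Ideal (pullbackRing φ D)) :
        FractionalIdeal (pullbackRing φ D)⁰ K) := by
  rw [FractionalIdeal.spanSingleton_mul_le_iff]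
  rintro _ ⟨t, ht, rfl⟩
  obtain ⟨d, hd⟩ := (FractionalIdeal.mem_spanSingleton _).1 (hJ ht)
  have h : φ (v * t) = d := by
    rw [map_mul, hv, ← hd, Algebra.smul_def, mul_comm, mul_assoc, mul_inv_cancel₀ hy, mul_one]
    rfl
  refine (FractionalIdeal.mem_coeIdeal _).2 ⟨⟨v * t, ?_⟩, ?_, map_mul (algebraMap T K) v t⟩
  · rw [Subring.mem_comap, h]
    exact d.2
  · change y * φ (v * t) ∈ J
    rwa [map_mul, hv, mul_inv_cancel_left₀ hy]

/-- For each y with J ⊆ yD, multiplying by a lift v of y⁻¹ moves t into (φ⁻¹(y⁻¹J))^* ⊆ R, and φ(t)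
= yφ(vt). The ideal J must be nonzero so that every such y is invertible. -/
theorem map_mem_of_algebraMap_mem {J : FractionalIdeal D⁰ k} (hJ : J ≠ 0) {t : T}
    (ht : algebraMap T K t ∈ star (preimageIdeal φ hφ D K J)) :
    φ t ∈ pullbackStarProj φ hφ D star J := by
  refine (mem_projFun star _).2 fun y hy => (mem_projTerm star (pullbackProj_surjective φ D hφ)).2 ?_
  have hy0 : y ≠ 0 := by
    rintro rfl
    rw [FractionalIdeal.spanSingleton_zero, ← FractionalIdeal.bot_eq_zero, le_bot_iff] at hy
    exact hJ hy
  obtain ⟨v, hv⟩ := hφ y⁻¹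
  have h := star.mono (preimageIdeal_smul_le (K := K) φ hφ D hy0 hv hy)
  rw [star.map_smul] at h
  have h1 := h (FractionalIdeal.mul_mem_mul (FractionalIdeal.mem_spanSingleton_self _ _) ht)
  obtain ⟨r, hr⟩ := mem_one_of_le_one (star.map_le_one FractionalIdeal.coeIdeal_le_one) h1
  refine ⟨r, ?_, ?_⟩
  · change algebraMap (pullbackRing φ D) K r ∈ star _
    rwa [hr]
  · have h2 : (r : T) = v * t := IsFractionRing.injective T K (hr.trans (map_mul _ _ _).symm)
    change φ t = y * φ r
    rw [h2, map_mul, hv, mul_inv_cancel_left₀ hy0]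

theorem algebraMap_mem_of_map_mem {J : FractionalIdeal D⁰ k} {t : T}
    (ht : φ t ∈ pullbackStarProj φ hφ D star J) :
    algebraMap T K t ∈ star (preimageIdeal φ hφ D K J) := by
  -- A single term of the intersection suffices: φ(t) = yφ(a) with va in the closure for a lift v of
  -- y, and t - va ∈ M ⊆ φ⁻¹(J).
  obtain ⟨y, hy⟩ := exists_le_spanSingleton J
  obtain ⟨a, ha, h⟩ := (mem_projTerm star (pullbackProj_surjective φ D hφ)).1
    ((mem_projFun star _).1 ht y hy)
  obtain ⟨v, hv⟩ := hφ y
  have h1 := star.mono (smul_preimageIdeal_le (K := K) φ hφ D hv J)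
  rw [star.map_smul] at h1
  have h2 : algebraMap T K v * algebraMap T K a ∈ star (preimageIdeal φ hφ D K J) :=
    h1 (FractionalIdeal.mul_mem_mul (FractionalIdeal.mem_spanSingleton_self _ _) ha)
  have h3 : φ (t - v * a) = 0 := by
    rw [map_sub, map_mul, hv]
    exact sub_eq_zero.2 h
  have h4 := Submodule.add_mem (star (preimageIdeal φ hφ D K J)).1 h2
    (star.le_map _ (algebraMap_mem_preimageIdeal_of_eq_zero φ hφ D h3))
  rwa [← map_mul, ← map_add, add_sub_cancel] at h4

theorem le_preimageIdeal_map (I : Ideal (pullbackRing φ D)) :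
    (I : FractionalIdeal (pullbackRing φ D)⁰ K) ≤
      preimageIdeal φ hφ D K (I.map (pullbackProj φ D) : Ideal D) := by
  intro x hx
  obtain ⟨r, hr, rfl⟩ := (FractionalIdeal.mem_coeIdeal _).1 hx
  exact ⟨r, FractionalIdeal.mem_coeIdeal_of_mem _ (Ideal.mem_map_of_mem _ hr), rfl⟩

theorem coeIdeal_map_ne_zero {I : Ideal (pullbackRing φ D)}
    (hI : ¬ I ≤ RingHom.ker (pullbackProj φ D)) :
    ((I.map (pullbackProj φ D) : Ideal D) : FractionalIdeal D⁰ k) ≠ 0 := by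
  rw [FractionalIdeal.coeIdeal_ne_zero]
  rwa [Ne, Ideal.map_eq_bot_iff_le_ker]

theorem map_mem_proj {I : Ideal (pullbackRing φ D)}
    (hI : ¬ I ≤ RingHom.ker (pullbackProj φ D)) {t : T}
    (ht : algebraMap T K t ∈ star (I : FractionalIdeal (pullbackRing φ D)⁰ K)) :
    φ t ∈ pullbackStarProj φ hφ D star (I.map (pullbackProj φ D) : Ideal D) :=
  map_mem_of_algebraMap_mem φ hφ D star (coeIdeal_map_ne_zero φ D hI)
    (star.mono (le_preimageIdeal_map φ hφ D I) ht)

/-- φ(I) ⊆ φ(I^*) ⊆ φ(I)^{*_φ}, so the closures agree. This reconciles star multiplication on R with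
that on D. -/
theorem proj_map_idealClosure {I : Ideal (pullbackRing φ D)}
    (hI : ¬ I ≤ RingHom.ker (pullbackProj φ D)) :
    pullbackStarProj φ hφ D star ((star.idealClosure I).map (pullbackProj φ D) : Ideal D) =
      pullbackStarProj φ hφ D star (I.map (pullbackProj φ D) : Ideal D) := by
  apply le_antisymm
  · rw [← StarOperation.idem _ ((I.map (pullbackProj φ D) : Ideal D) : FractionalIdeal D⁰ k)]
    refine StarOperation.mono _ fun x hx => ?_
    obtain ⟨d, hd, rfl⟩ := (FractionalIdeal.mem_coeIdeal _).1 hx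
    obtain ⟨r, hr, rfl⟩ :=
      (Ideal.mem_map_iff_of_surjective _ (pullbackProj_surjective φ D hφ)).1 hd
    exact map_mem_proj φ hφ D star hI hr
  · exact StarOperation.mono _ ((FractionalIdeal.coeIdeal_le_coeIdeal k).2
      (Ideal.map_mono (star.le_idealClosure I)))

theorem map_span_singleton_eq (r : pullbackRing φ D) :
    (((Ideal.span {r}).map (pullbackProj φ D) : Ideal D) : FractionalIdeal D⁰ k) =
      FractionalIdeal.spanSingleton D⁰ (φ r) := by
  rw [Ideal.map_span, Set.image_singleton, FractionalIdeal.coeIdeal_span_singleton]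
  rfl

include hφ hD in
/-- An integral ideal of `R` that is `*`-invertible has, up to a principal factor, a
`*`-inverse that is an integral ideal of `R` not contained in `M`. -/
theorem exists_coeIdeal_mul_eq {I : Ideal (pullbackRing φ D)}
    (hI : ¬ I ≤ RingHom.ker (pullbackProj φ D))
    (hs : star.IsInvertibleStarIdeal (I : FractionalIdeal (pullbackRing φ D)⁰ K)) :
    ∃ (J : Ideal (pullbackRing φ D)) (a : pullbackRing φ D),
      ¬ I * J ≤ RingHom.ker (pullbackProj φ D) ∧ φ a ≠ 0 ∧
      star.idealClosure (I * J) = Ideal.span {a} := by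
  obtain ⟨w, J, hw, hJ, h⟩ := exists_eq_smul_coeIdeal φ hφ D hD star hs.inv
  have h1 : star ((I * J : Ideal (pullbackRing φ D)) : FractionalIdeal _ K) =
      FractionalIdeal.spanSingleton _ w⁻¹ := by
    have h2 := hs.2.2
    rw [h, mul_left_comm, star.map_smul] at h2
    rw [FractionalIdeal.coeIdeal_mul, ← spanSingleton_inv_mul_cancel_left hw (star _), h2, mul_one]
  have hIJ := not_mul_le_ker φ D hI hJ
  obtain ⟨a, ha⟩ := mem_one_of_le_one (star.map_le_one FractionalIdeal.coeIdeal_le_one)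
    (h1 ▸ FractionalIdeal.mem_spanSingleton_self _ _)
  have h3 : star.idealClosure (I * J) = Ideal.span {a} := by
    rw [← FractionalIdeal.coeIdeal_inj (K := K), star.coe_idealClosure, h1,
      FractionalIdeal.coeIdeal_span_singleton, ha]
  -- IJ ⊆ aR, so φ(a) = 0 would put IJ inside M.
  refine ⟨J, a, hIJ, fun h0 => hIJ ?_, h3⟩
  refine (star.le_idealClosure _).trans (h3.le.trans ?_)
  rw [Ideal.span_singleton_le_iff_mem]
  exact Subtype.ext h0

include hD in
theorem isInvertibleStarIdeal_proj_map {H : FractionalIdeal (pullbackRing φ D)⁰ K}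
    (hH : star.IsInvertibleStarIdeal H) {z : K} {I : Ideal (pullbackRing φ D)} (hz : z ≠ 0)
    (hI : ¬ I ≤ RingHom.ker (pullbackProj φ D))
    (h : H = FractionalIdeal.spanSingleton _ z * (I : FractionalIdeal (pullbackRing φ D)⁰ K)) :
    (pullbackStarProj φ hφ D star).IsInvertibleStarIdeal
      (pullbackStarProj φ hφ D star (I.map (pullbackProj φ D) : Ideal D)) := by
  subst h
  rw [star.isInvertibleStarIdeal_smul_iff hz] at hH
  obtain ⟨J, a, hIJ, ha, h⟩ := exists_coeIdeal_mul_eq φ hφ D hD star hI hH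
  refine isInvertibleStarIdeal_map _ (J := (J.map (pullbackProj φ D) : Ideal D)) ha ?_
  rw [← FractionalIdeal.coeIdeal_mul, ← Ideal.map_mul,
    ← proj_map_idealClosure φ hφ D star hIJ, h, map_span_singleton_eq]
  exact StarOperation.map_spanSingleton' _ _ ha

/-- The class of the closure of `φ(I)` depends only on the class of `I`. -/
theorem cls_proj_map_eq {z w : K} {I J : Ideal (pullbackRing φ D)} (hz : z ≠ 0)
    (hI : ¬ I ≤ RingHom.ker (pullbackProj φ D)) (hJ : ¬ J ≤ RingHom.ker (pullbackProj φ D))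
    (h : FractionalIdeal.spanSingleton _ z * (I : FractionalIdeal (pullbackRing φ D)⁰ K) =
      FractionalIdeal.spanSingleton _ w * (J : FractionalIdeal (pullbackRing φ D)⁰ K))
    (hI' : (pullbackStarProj φ hφ D star).IsInvertibleStarIdeal
      (pullbackStarProj φ hφ D star (I.map (pullbackProj φ D) : Ideal D)))
    (hJ' : (pullbackStarProj φ hφ D star).IsInvertibleStarIdeal
      (pullbackStarProj φ hφ D star (J.map (pullbackProj φ D) : Ideal D))) :
    StarOperation.cls _ _ hI' = StarOperation.cls _ _ hJ' := by
  obtain ⟨r, hr, hr0⟩ := (not_le_ker_iff φ D).1 hJ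
  obtain ⟨r', hr', hr0'⟩ := (not_le_ker_iff φ D).1 hI
  have hrK : algebraMap (pullbackRing φ D) K r ≠ 0 := by
    intro h0
    rw [IsFractionRing.to_map_eq_zero_iff] at h0
    exact hr0 (by rw [h0]; exact map_zero φ)
  -- With r ∈ J outside M, write wr = zq with q ∈ I. Then zI = wJ becomes rI = qJ, a relation inside
  -- R to which φ applies.
  have h1 : w * algebraMap (pullbackRing φ D) K r ∈
      FractionalIdeal.spanSingleton _ z * (I : FractionalIdeal (pullbackRing φ D)⁰ K) := by
    rw [h]
    exact FractionalIdeal.mul_mem_mul (FractionalIdeal.mem_spanSingleton_self _ _)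
      (FractionalIdeal.mem_coeIdeal_of_mem _ hr)
  obtain ⟨x, hx, h2⟩ := FractionalIdeal.mem_singleton_mul.1 h1
  obtain ⟨q, hq, rfl⟩ := (FractionalIdeal.mem_coeIdeal _).1 hx
  have h3 : Ideal.span {r} * I = Ideal.span {q} * J := by
    rw [← FractionalIdeal.coeIdeal_inj (K := K), FractionalIdeal.coeIdeal_mul,
      FractionalIdeal.coeIdeal_mul, FractionalIdeal.coeIdeal_span_singleton,
      FractionalIdeal.coeIdeal_span_singleton]
    apply spanSingleton_mul_injective hz
    change FractionalIdeal.spanSingleton _ z * (_ * _) =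
      FractionalIdeal.spanSingleton _ z * (_ * _)
    rw [mul_left_comm, h, ← mul_assoc, ← mul_assoc,
      FractionalIdeal.spanSingleton_mul_spanSingleton,
      FractionalIdeal.spanSingleton_mul_spanSingleton, mul_comm _ w, h2]
  -- rr' ∈ rI = qJ and φ(rr') ≠ 0, so q cannot be in M.
  have hq0 : φ q ≠ 0 := by
    intro h0
    have h4 : r * r' ∈ Ideal.span {q} * J :=
      h3 ▸ Ideal.mul_mem_mul (Ideal.mem_span_singleton_self r) hr'
    obtain ⟨j, -, hj⟩ := Ideal.mem_span_singleton_mul.1 h4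
    have h5 := congrArg (fun x : pullbackRing φ D => φ x) hj
    simp only [Subring.coe_mul, map_mul, h0, zero_mul] at h5
    exact mul_ne_zero hr0 hr0' h5.symm
  have h6 := congrArg (fun I : Ideal (pullbackRing φ D) =>
    pullbackStarProj φ hφ D star (I.map (pullbackProj φ D) : Ideal D)) h3
  simp only [Ideal.map_mul, FractionalIdeal.coeIdeal_mul, map_span_singleton_eq,
    StarOperation.map_smul] at h6
  rw [← cls_smul _ hI' hr0 (hI'.smul hr0), ← cls_smul _ hJ' hq0 (hJ'.smul hq0)]
  exact cls_congr _ h6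

-- One class is asserted to serve all factorizations zH' at once, so that the value later picked by
-- `choose` obeys the formula for each of them.
include hD in
theorem exists_cls_proj (H : star.InvIdeals) :
    ∃ c : (pullbackStarProj φ hφ D star).Cl, ∀ (z : K) (I : Ideal (pullbackRing φ D)), z ≠ 0 →
      ¬ I ≤ RingHom.ker (pullbackProj φ D) →
      H.1 = FractionalIdeal.spanSingleton _ z * (I : FractionalIdeal (pullbackRing φ D)⁰ K) →
      ∃ hI : (pullbackStarProj φ hφ D star).IsInvertibleStarIdeal
        (pullbackStarProj φ hφ D star (I.map (pullbackProj φ D) : Ideal D)),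
        c = StarOperation.cls _ _ hI := by
  obtain ⟨z, I, hz, hI, h⟩ := exists_eq_smul_coeIdeal φ hφ D hD star H.2
  refine ⟨StarOperation.cls _ _
    (isInvertibleStarIdeal_proj_map φ hφ D hD star H.2 hz hI h), fun w J hw hJ h' => ?_⟩
  exact ⟨isInvertibleStarIdeal_proj_map φ hφ D hD star H.2 hw hJ h',
    cls_proj_map_eq φ hφ D star hz hI hJ (h.symm.trans h') _ _⟩

/-- The homomorphism `Inv^*(R) → Cl^{*_φ}(D)`, `H = z H' ↦ [φ(H')^{*_φ}]`. -/
noncomputable def projInv : star.InvIdeals →* (pullbackStarProj φ hφ D star).Cl :=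
  MonoidHom.mk' (fun H => (exists_cls_proj φ hφ D hD star H).choose) fun H J => by
    obtain ⟨z, I, hz, hI, h⟩ := exists_eq_smul_coeIdeal φ hφ D hD star H.2
    obtain ⟨w, I', hw, hI', h'⟩ := exists_eq_smul_coeIdeal φ hφ D hD star J.2
    have hII := not_mul_le_ker φ D hI hI'
    obtain ⟨_, h1⟩ := (exists_cls_proj φ hφ D hD star H).choose_spec z I hz hI h
    obtain ⟨_, h2⟩ := (exists_cls_proj φ hφ D hD star J).choose_spec w I' hw hI' h'
    have h3 : (H * J).1 = FractionalIdeal.spanSingleton _ (z * w) *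
        ((star.idealClosure (I * I') : Ideal (pullbackRing φ D)) :
          FractionalIdeal (pullbackRing φ D)⁰ K) := by
      change star (H.1 * J.1) = _
      rw [h, h', mul_mul_mul_comm, FractionalIdeal.spanSingleton_mul_spanSingleton, star.map_smul,
        star.coe_idealClosure, FractionalIdeal.coeIdeal_mul]
    obtain ⟨_, h4⟩ := (exists_cls_proj φ hφ D hD star (H * J)).choose_spec (z * w) _
      (mul_ne_zero hz hw) (fun h0 => hII ((star.le_idealClosure _).trans h0)) h3
    rw [h1, h2, h4, cls_mul]
    refine cls_congr _ ?_
    rw [proj_map_idealClosure φ hφ D star hII, StarOperation.map_mul_left,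
      StarOperation.map_mul_right, Ideal.map_mul, FractionalIdeal.coeIdeal_mul]

theorem projInv_apply {H : star.InvIdeals} {z : K} {I : Ideal (pullbackRing φ D)} (hz : z ≠ 0)
    (hI : ¬ I ≤ RingHom.ker (pullbackProj φ D))
    (h : H.1 = FractionalIdeal.spanSingleton _ z *
      (I : FractionalIdeal (pullbackRing φ D)⁰ K)) :
    projInv φ hφ D hD star H = StarOperation.cls _ _
      (isInvertibleStarIdeal_proj_map φ hφ D hD star H.2 hz hI h) :=
  ((exists_cls_proj φ hφ D hD star H).choose_spec z I hz hI h).choose_spec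

/-- The homomorphism `Cl^*(R) → Cl^{*_φ}(D)`, `[z H'] ↦ [φ(H')^{*_φ}]`. -/
noncomputable def projCl : star.Cl →* (pullbackStarProj φ hφ D star).Cl :=
  QuotientGroup.lift _ (projInv φ hφ D hD star) <| by
    rintro _ ⟨x, rfl⟩
    have h : (star.principal x).1 = FractionalIdeal.spanSingleton _ (x : K) *
        ((⊤ : Ideal (pullbackRing φ D)) : FractionalIdeal (pullbackRing φ D)⁰ K) := by
      rw [FractionalIdeal.coeIdeal_top, mul_one]
      rfl
    rw [MonoidHom.mem_ker, projInv_apply φ hφ D hD star x.ne_zero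
      (fun h0 => RingHom.ker_ne_top _ (top_le_iff.1 h0)) h]
    refine (cls_congr _ ?_).trans
      (cls_spanSingleton _ one_ne_zero (isInvertibleStarIdeal_spanSingleton _ 1))
    rw [Ideal.map_top, FractionalIdeal.coeIdeal_top, StarOperation.map_one,
      FractionalIdeal.spanSingleton_one]

theorem projCl_cls {H : FractionalIdeal (pullbackRing φ D)⁰ K}
    (hH : star.IsInvertibleStarIdeal H) {z : K} {I : Ideal (pullbackRing φ D)} (hz : z ≠ 0)
    (hI : ¬ I ≤ RingHom.ker (pullbackProj φ D))
    (h : H = FractionalIdeal.spanSingleton _ z *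
      (I : FractionalIdeal (pullbackRing φ D)⁰ K)) :
    projCl φ hφ D hD star (star.cls H hH) = StarOperation.cls _ _
      (isInvertibleStarIdeal_proj_map φ hφ D hD star hH hz hI h) :=
  projInv_apply φ hφ D hD star (H := ⟨H, hH⟩) hz hI h

end Projection

/-! ### The homomorphism α, the splitting, and exactness at Cl^*(R). -/

section Splitting

variable {T K k : Type*} [CommRing T] [IsDomain T] [Field K] [Algebra T K] [IsFractionRing T K]
  [Field k] (φ : T →+* k) (hφ : Function.Surjective φ) [Fact (RingHom.ker φ ≠ ⊥)] (D : Subring k)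
  [IsFractionRing D k] (hD : D ≠ ⊤) (hU : Function.Surjective (unitsQuotientMap φ D))
  (star : StarOperation (pullbackRing φ D) K)

open StarOperation

include hU in
theorem exists_unit_map_eq {y : k} (hy : y ≠ 0) : ∃ (u : Tˣ) (d : Dˣ), φ u = y * (d : D) := by
  obtain ⟨u, hu⟩ := hU (QuotientGroup.mk (Units.mk0 y hy))
  obtain ⟨d, hd⟩ := QuotientGroup.eq.1 hu.symm
  refine ⟨u, d, ?_⟩
  have h := congrArg Units.val hd
  simp only [Units.val_mul, Units.val_inv_eq_inv_val] at h
  change ((d : D) : k) = y⁻¹ * φ u at h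
  rw [h, mul_inv_cancel_left₀ hy]

include hU in
theorem exists_unit_map_mem {J : FractionalIdeal D⁰ k} (hJ : J ≠ 0) : ∃ u : Tˣ, φ u ∈ J := by
  obtain ⟨y, hy, hy0⟩ : ∃ y ∈ J, y ≠ 0 := by
    by_contra! h
    exact hJ (FractionalIdeal.eq_zero_iff.2 h)
  obtain ⟨u, d, hu⟩ := exists_unit_map_eq φ D hU hy0
  refine ⟨u, ?_⟩
  have := Submodule.smul_mem (J : Submodule D k) (d : D) hy
  rwa [Algebra.smul_def, mul_comm, show algebraMap D k d = ((d : D) : k) from rfl, ← hu] at this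

theorem fractionalIdeal_mul_ne_zero {I J : FractionalIdeal D⁰ k} (hI : I ≠ 0) (hJ : J ≠ 0) :
    I * J ≠ 0 := by
  contrapose! hI
  obtain ⟨y, hy, hy0⟩ : ∃ y ∈ J, y ≠ 0 := by
    by_contra! h
    exact hJ (FractionalIdeal.eq_zero_iff.2 h)
  refine FractionalIdeal.eq_zero_iff.2 fun x hx => ?_
  have h := FractionalIdeal.mul_mem_mul hx hy
  rw [hI, FractionalIdeal.mem_zero_iff] at h
  exact (mul_eq_zero.1 h).resolve_right hy0

theorem spanSingleton_le_preimageIdeal {J : FractionalIdeal D⁰ k} {t : T} (h : φ t ∈ J) :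
    FractionalIdeal.spanSingleton _ (algebraMap T K t) ≤ preimageIdeal φ hφ D K J :=
  FractionalIdeal.spanSingleton_le_iff_mem.2 ((algebraMap_mem_preimageIdeal φ hφ D).2 h)

/-- As φ(u)D = yD and u is a unit of T, φ(t) ∈ yD is equivalent to φ(tu⁻¹) ∈ D, that is, to t ∈ uR.
-/
theorem preimageIdeal_spanSingleton {u : Tˣ} {d : Dˣ} {y : k} (h : φ u = y * (d : D)) :
    preimageIdeal φ hφ D K (FractionalIdeal.spanSingleton _ y) =
      FractionalIdeal.spanSingleton _ (algebraMap T K u) := by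
  apply le_antisymm
  · rintro _ ⟨t, ht, rfl⟩
    obtain ⟨e, he⟩ := (FractionalIdeal.mem_spanSingleton _).1 ht
    have he' : (e : k) * y = φ t := he
    have hd : ((d : D) : k) * ((d⁻¹ : Dˣ) : D) = 1 := congrArg Subtype.val d.mul_inv
    have hu : φ u * φ (u⁻¹ : Tˣ) = 1 := by rw [← map_mul, u.mul_inv, _root_.map_one]
    have h1 : φ (t * (u⁻¹ : Tˣ)) ∈ D := by
      have h2 : φ (t * (u⁻¹ : Tˣ)) = e * ((d⁻¹ : Dˣ) : D) := by
        have h3 : φ u ≠ 0 := left_ne_zero_of_mul_eq_one hu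
        apply mul_left_cancel₀ h3
        rw [map_mul, ← he', mul_left_comm, hu, h]
        linear_combination (-(e : k) * y) * hd
      rw [h2]
      exact D.mul_mem e.2 (Subtype.coe_prop _)
    refine (FractionalIdeal.mem_spanSingleton _).2 ⟨⟨t * (u⁻¹ : Tˣ), h1⟩, ?_⟩
    change (t * (u⁻¹ : Tˣ) : T) • algebraMap T K u = _
    rw [Algebra.smul_def, ← map_mul, mul_assoc, u.inv_mul, mul_one]
  · refine spanSingleton_le_preimageIdeal φ hφ D ?_
    rw [h]
    exact (FractionalIdeal.mem_spanSingleton _).2 ⟨d, mul_comm _ _⟩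

theorem preimageIdeal_one : preimageIdeal φ hφ D K 1 = 1 := by
  have h := preimageIdeal_spanSingleton (K := K) φ hφ D (u := 1) (d := 1) (y := 1) (by simp)
  simpa using h

-- Products of lifts cover φ⁻¹(IJ) modulo M, so the point is that the product contains M. For m ∈ M
-- write m = (mu⁻¹)u, with u a unit of T in φ⁻¹(J); such a unit exists because J ≠ 0.
include hU in
theorem preimageIdeal_mul {I J : FractionalIdeal D⁰ k} (hJ : J ≠ 0) :
    preimageIdeal φ hφ D K (I * J) = preimageIdeal φ hφ D K I * preimageIdeal φ hφ D K J := by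
  apply le_antisymm
  · obtain ⟨u, hu⟩ := exists_unit_map_mem φ D hU hJ
    have hM : ∀ m, φ m = 0 → algebraMap T K m ∈
        preimageIdeal φ hφ D K I * preimageIdeal φ hφ D K J := fun m hm => by
      have h := FractionalIdeal.mul_mem_mul
        (algebraMap_mem_preimageIdeal_of_eq_zero (K := K) φ hφ D (J := I)
          (t := m * (u⁻¹ : Tˣ)) (by rw [map_mul, hm, zero_mul]))
        ((algebraMap_mem_preimageIdeal (K := K) φ hφ D).2 hu)
      rwa [← map_mul, mul_assoc, u.inv_mul, mul_one] at h
    rintro _ ⟨t, ht, rfl⟩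
    have key : ∀ x ∈ I * J, ∃ t, φ t = x ∧ algebraMap T K t ∈
        preimageIdeal φ hφ D K I * preimageIdeal φ hφ D K J := fun x hx => by
      refine FractionalIdeal.mul_induction_on hx (fun i hi j hj => ?_) ?_
      · obtain ⟨a, rfl⟩ := hφ i
        obtain ⟨b, rfl⟩ := hφ j
        refine ⟨a * b, map_mul _ _ _, ?_⟩
        rw [map_mul]
        exact FractionalIdeal.mul_mem_mul ⟨a, hi, rfl⟩ ⟨b, hj, rfl⟩
      · rintro _ _ ⟨a, rfl, ha⟩ ⟨b, rfl, hb⟩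
        refine ⟨a + b, map_add _ _ _, ?_⟩
        rw [map_add]
        exact Submodule.add_mem
          (preimageIdeal φ hφ D K I * preimageIdeal φ hφ D K J : FractionalIdeal _ K).1 ha hb
    obtain ⟨t', h, h'⟩ := key _ ht
    have h1 := Submodule.add_mem
      (preimageIdeal φ hφ D K I * preimageIdeal φ hφ D K J : FractionalIdeal _ K).1 h'
      (hM (t - t') (by rw [map_sub, h, sub_self]))
    rwa [← map_add, add_sub_cancel] at h1
  · rw [FractionalIdeal.mul_le]
    rintro _ ⟨a, ha, rfl⟩ _ ⟨b, hb, rfl⟩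
    refine ⟨a * b, ?_, map_mul _ _ _⟩
    rw [map_mul]
    exact FractionalIdeal.mul_mem_mul ha hb

include hU in
theorem map_preimageIdeal {J : FractionalIdeal D⁰ k} (hJ : J ≠ 0) :
    star (preimageIdeal φ hφ D K J) =
      preimageIdeal φ hφ D K (pullbackStarProj φ hφ D star J) := by
  apply le_antisymm
  · intro x hx
    obtain ⟨y, hy⟩ := exists_le_spanSingleton J
    have hy0 : y ≠ 0 := by
      rintro rfl
      rw [FractionalIdeal.spanSingleton_zero, ← FractionalIdeal.bot_eq_zero, le_bot_iff] at hy
      exact hJ hy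
    -- J ⊆ yD gives φ⁻¹(J) ⊆ uR, which is principal, hence closed, and lies in T. So x comes from T
    -- and the elementwise comparison applies.
    obtain ⟨u, d, hu⟩ := exists_unit_map_eq φ D hU hy0
    have h := star.mono (preimageIdeal_mono (K := K) φ hφ D hy)
    rw [preimageIdeal_spanSingleton φ hφ D hu,
      star.map_spanSingleton' _ (by simp)] at h
    obtain ⟨r, rfl⟩ := (FractionalIdeal.mem_spanSingleton _).1 (h hx)
    have h1 : r • algebraMap T K u = algebraMap T K (r * u) :=
      (Algebra.smul_def (r : T) _).trans (map_mul _ _ _).symm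
    rw [h1] at hx ⊢
    exact (algebraMap_mem_preimageIdeal φ hφ D).2 (map_mem_of_algebraMap_mem φ hφ D star hJ hx)
  · rintro _ ⟨t, ht, rfl⟩
    exact algebraMap_mem_of_map_mem φ hφ D star ht

include hU in
theorem map_preimageIdeal_mul {I J : FractionalIdeal D⁰ k} (hI : I ≠ 0) (hJ : J ≠ 0) :
    star (preimageIdeal φ hφ D K I * preimageIdeal φ hφ D K J) =
      preimageIdeal φ hφ D K (pullbackStarProj φ hφ D star (I * J)) := by
  rw [← preimageIdeal_mul φ hφ D hU hJ, map_preimageIdeal φ hφ D hU star (fractionalIdeal_mul_ne_zero D hI hJ)]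

include hU in
theorem isInvertibleStarIdeal_preimageIdeal {J : FractionalIdeal D⁰ k}
    (hJ : (pullbackStarProj φ hφ D star).IsInvertibleStarIdeal J) :
    star.IsInvertibleStarIdeal (preimageIdeal φ hφ D K J) := by
  refine isInvertibleStarIdeal_of_map_mul _ (J := preimageIdeal φ hφ D K J⁻¹) ?_ ?_
  · rw [map_preimageIdeal φ hφ D hU star hJ.1, hJ.2.1]
  · rw [map_preimageIdeal_mul φ hφ D hU star hJ.1 hJ.inv.1, hJ.2.2, preimageIdeal_one]

/-- The homomorphism `Inv^{*_φ}(D) → Inv^*(R)`, `J ↦ φ⁻¹(J)`. -/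
noncomputable def preimageInv : (pullbackStarProj φ hφ D star).InvIdeals →* star.InvIdeals :=
  MonoidHom.mk'
    (fun J => ⟨preimageIdeal φ hφ D K J.1,
      isInvertibleStarIdeal_preimageIdeal φ hφ D hU star J.2⟩)
    fun I J => Subtype.ext (map_preimageIdeal_mul φ hφ D hU star I.2.1 J.2.1).symm

/-- The homomorphism `Cl^{*_φ}(D) → Cl^*(R)`, `[J] ↦ [φ⁻¹(J)]`. -/
noncomputable def preimageCl : (pullbackStarProj φ hφ D star).Cl →* star.Cl :=
  QuotientGroup.map _ _ (preimageInv φ hφ D hU star) <| by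
    rintro _ ⟨y, rfl⟩
    obtain ⟨u, d, hu⟩ := exists_unit_map_eq φ D hU y.ne_zero
    exact ⟨Units.map (algebraMap T K : T →* K) u,
      Subtype.ext (preimageIdeal_spanSingleton φ hφ D hu).symm⟩

theorem preimageCl_cls {J : FractionalIdeal D⁰ k}
    (hJ : (pullbackStarProj φ hφ D star).IsInvertibleStarIdeal J) :
    preimageCl φ hφ D hU star (StarOperation.cls _ J hJ) = star.cls (preimageIdeal φ hφ D K J)
      (isInvertibleStarIdeal_preimageIdeal φ hφ D hU star hJ) := rfl

theorem preimageIdeal_coeIdeal (J : Ideal D) :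
    preimageIdeal φ hφ D K (J : FractionalIdeal D⁰ k) =
      (J.comap (pullbackProj φ D) : Ideal (pullbackRing φ D)) := by
  ext x
  constructor
  · rintro ⟨t, ht, rfl⟩
    obtain ⟨d, hd, h⟩ := (FractionalIdeal.mem_coeIdeal _).1 ht
    have h' : φ t = d := h.symm
    refine (FractionalIdeal.mem_coeIdeal _).2
      ⟨⟨t, by rw [Subring.mem_comap, h']; exact d.2⟩, ?_, rfl⟩
    rw [Ideal.mem_comap]
    convert hd
    exact Subtype.ext h'
  · intro hx
    obtain ⟨r, hr, rfl⟩ := (FractionalIdeal.mem_coeIdeal _).1 hx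
    have h : algebraMap D k (pullbackProj φ D r) ∈ (J : FractionalIdeal D⁰ k) :=
      FractionalIdeal.mem_coeIdeal_of_mem _ hr
    exact ⟨r, h, rfl⟩

theorem projCl_comp_preimageCl :
    (projCl φ hφ D hD star).comp (preimageCl φ hφ D hU star) = MonoidHom.id _ := by
  refine MonoidHom.ext fun c => ?_
  obtain ⟨⟨J, hJ⟩, rfl⟩ := QuotientGroup.mk_surjective c
  -- The class of J is that of an integral ideal J' ≠ 0 of D. Then φ⁻¹(J') is an ideal of R not
  -- contained in M, usable in the formula for γ with z = 1.
  obtain ⟨a, J', ha, rfl⟩ := FractionalIdeal.exists_eq_spanSingleton_mul J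
  have ha' : (algebraMap D k a)⁻¹ ≠ 0 := by simpa using ha
  have hJ' := ((isInvertibleStarIdeal_smul_iff _ ha').1 hJ)
  have hJ0 : J' ≠ ⊥ := FractionalIdeal.coeIdeal_ne_zero.1 hJ'.1
  have h1 : (QuotientGroup.mk ⟨_, hJ⟩ : (pullbackStarProj φ hφ D star).Cl) =
    StarOperation.cls _ _ hJ' := cls_smul _ hJ' ha' hJ
  have hs := pullbackProj_surjective φ D hφ
  have hker : ¬ J'.comap (pullbackProj φ D) ≤ RingHom.ker (pullbackProj φ D) := by
    intro h
    refine hJ0 ?_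
    rw [← Ideal.map_comap_of_surjective _ hs J', Ideal.map_eq_bot_iff_le_ker]
    exact h
  rw [h1, MonoidHom.comp_apply, preimageCl_cls]
  have h2 := projCl_cls φ hφ D hD star (isInvertibleStarIdeal_preimageIdeal φ hφ D hU star hJ')
    one_ne_zero hker
    (by rw [FractionalIdeal.spanSingleton_one, one_mul, preimageIdeal_coeIdeal])
  refine h2.trans (cls_congr _ ?_)
  rw [Ideal.map_comap_of_surjective _ hs, hJ'.2.1]

include hU in
theorem extendIdeal_preimageIdeal {J : FractionalIdeal D⁰ k} (hJ : J ≠ 0) :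
    extendIdeal (preimageIdeal φ hφ D K J) = 1 := by
  apply le_antisymm
  · rw [extendIdeal_le]
    rintro _ ⟨t, -, rfl⟩
    exact (FractionalIdeal.mem_one_iff _).2 ⟨t, rfl⟩
  · obtain ⟨u, hu⟩ := exists_unit_map_mem φ D hU hJ
    have h := Submodule.smul_mem (extendIdeal (preimageIdeal φ hφ D K J) : Submodule T K)
      (u⁻¹ : Tˣ).1 (mem_extendIdeal ((algebraMap_mem_preimageIdeal (K := K) φ hφ D).2 hu))
    rw [Algebra.smul_def, ← map_mul, u.inv_mul, _root_.map_one] at h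
    rw [← FractionalIdeal.spanSingleton_one]
    exact FractionalIdeal.spanSingleton_le_iff_mem.2 h

/-- IT = T gives M = IT·M ⊆ I, and an ideal containing the kernel is the preimage of its image. -/
theorem coeIdeal_eq_preimageIdeal {I : Ideal (pullbackRing φ D)}
    (hI : extendIdeal (I : FractionalIdeal (pullbackRing φ D)⁰ K) = 1) :
    (I : FractionalIdeal (pullbackRing φ D)⁰ K) =
      preimageIdeal φ hφ D K (I.map (pullbackProj φ D) : Ideal D) := by
  refine le_antisymm (le_preimageIdeal_map φ hφ D I) ?_
  rw [preimageIdeal_coeIdeal, Ideal.comap_map_of_surjective _ (pullbackProj_surjective φ D hφ),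
    FractionalIdeal.coeIdeal_le_coeIdeal, sup_le_iff]
  refine ⟨le_rfl, fun m hm => ?_⟩
  have h1 : (1 : K) ∈ extendIdeal (I : FractionalIdeal (pullbackRing φ D)⁰ K) := by
    rw [hI]
    exact FractionalIdeal.one_mem_one _
  have h2 := mul_mem_of_mem_extendIdeal φ hφ D h1 (m := m) (congrArg Subtype.val hm)
  rw [one_mul] at h2
  obtain ⟨r, hr, h⟩ := (FractionalIdeal.mem_coeIdeal _).1 h2
  rwa [← show r = m from Subtype.ext (IsFractionRing.injective T K h)]

include hφ hD hU in
/-- If `HT` is principal, `H` is a multiple of an ideal `I` of `R` with `IT = T`. -/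
theorem exists_eq_smul_of_extendIdeal_eq {H : FractionalIdeal (pullbackRing φ D)⁰ K}
    (hH : star.IsInvertibleStarIdeal H) {x : K}
    (h : extendIdeal H = FractionalIdeal.spanSingleton T⁰ x) :
    ∃ (z : K) (I : Ideal (pullbackRing φ D)), z ≠ 0 ∧
      ¬ I ≤ RingHom.ker (pullbackProj φ D) ∧
      H = FractionalIdeal.spanSingleton _ z * (I : FractionalIdeal (pullbackRing φ D)⁰ K) ∧
      extendIdeal (I : FractionalIdeal (pullbackRing φ D)⁰ K) = 1 := by
  obtain ⟨z, I, hz, hI, rfl⟩ := exists_eq_smul_coeIdeal φ hφ D hD star hH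
  have h1 : extendIdeal (I : FractionalIdeal (pullbackRing φ D)⁰ K) =
      FractionalIdeal.spanSingleton T⁰ (z⁻¹ * x) := by
    rw [← FractionalIdeal.spanSingleton_mul_spanSingleton, ← h, extendIdeal_smul,
      spanSingleton_inv_mul_cancel_left hz]
  obtain ⟨t, ht⟩ := mem_one_of_le_one (extendIdeal_coeIdeal_le_one I)
    (h1 ▸ FractionalIdeal.mem_spanSingleton_self _ _)
  rw [← ht] at h1
  -- IT = tT contains an element that φ sends to 1.
  have ht0 : φ t ≠ 0 := by
    intro h0
    obtain ⟨a, ha, ha1⟩ := exists_mem_extendIdeal_map_eq_one (K := K) φ hφ D hI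
    rw [h1] at ha
    obtain ⟨b, hb⟩ := (FractionalIdeal.mem_spanSingleton _).1 ha
    rw [Algebra.smul_def, ← map_mul] at hb
    rw [← IsFractionRing.injective T K hb, map_mul, h0, mul_zero] at ha1
    exact zero_ne_one ha1
  obtain ⟨u, d, hu⟩ := exists_unit_map_eq φ D hU ht0
  have htK : algebraMap T K t ≠ 0 := by
    intro h0
    rw [IsFractionRing.to_map_eq_zero_iff] at h0
    exact ht0 (by rw [h0, map_zero])
  have huK : algebraMap T K u ≠ 0 := by simp
  -- Take w = u/t, so that wIT = uT = T. Moreover wI ⊆ R: an element of I is bt with φ(bt) ∈ D, and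
  -- w·bt = ub has image φ(bt)·d ∈ D.
  obtain ⟨w, hw⟩ : ∃ w, w = algebraMap T K u * (algebraMap T K t)⁻¹ := ⟨_, rfl⟩
  have hw0 : w ≠ 0 := hw ▸ mul_ne_zero huK (inv_ne_zero htK)
  have hle : FractionalIdeal.spanSingleton _ w *
      (I : FractionalIdeal (pullbackRing φ D)⁰ K) ≤ 1 := by
    rw [FractionalIdeal.spanSingleton_mul_le_iff]
    intro y hy
    have hy' := mem_extendIdeal hy
    rw [h1] at hy'
    obtain ⟨b, rfl⟩ := (FractionalIdeal.mem_spanSingleton _).1 hy'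
    obtain ⟨c, hcD, hc⟩ := exists_algebraMap_of_mem_one φ D
      (FractionalIdeal.coeIdeal_le_one hy)
    rw [Algebra.smul_def, ← map_mul] at hc
    rw [IsFractionRing.injective T K hc, map_mul] at hcD
    refine (FractionalIdeal.mem_one_iff _).2 ⟨⟨u * b, ?_⟩, ?_⟩
    · rw [Subring.mem_comap, map_mul, hu, mul_right_comm, mul_comm (φ t)]
      exact D.mul_mem hcD (d : D).2
    · change algebraMap T K (u * b) = _
      rw [hw, Algebra.smul_def, map_mul]
      field_simp
  obtain ⟨I', hI'⟩ := FractionalIdeal.le_one_iff_exists_coeIdeal.1 hle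
  have h2 : extendIdeal (I' : FractionalIdeal (pullbackRing φ D)⁰ K) = 1 := by
    rw [hI', extendIdeal_smul, h1, FractionalIdeal.spanSingleton_mul_spanSingleton, hw,
      inv_mul_cancel_right₀ htK]
    refine le_antisymm ?_ ?_
    · rw [FractionalIdeal.spanSingleton_le_iff_mem, FractionalIdeal.mem_one_iff]
      exact ⟨u, rfl⟩
    · rw [← FractionalIdeal.spanSingleton_one, FractionalIdeal.spanSingleton_le_iff_mem,
        FractionalIdeal.mem_spanSingleton]
      exact ⟨(u⁻¹ : Tˣ).1, by rw [Algebra.smul_def, ← map_mul, u.inv_mul, _root_.map_one]⟩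
  refine ⟨z * w⁻¹, I', mul_ne_zero hz (inv_ne_zero hw0), fun h0 => ?_, ?_, h2⟩
  · have h3 : extendIdeal (I' : FractionalIdeal (pullbackRing φ D)⁰ K) ≤
        ((RingHom.ker φ : Ideal T) : FractionalIdeal T⁰ K) := by
      rw [extendIdeal_le]
      intro y hy
      obtain ⟨r, hr, rfl⟩ := (FractionalIdeal.mem_coeIdeal _).1 hy
      exact FractionalIdeal.mem_coeIdeal_of_mem _ (congrArg Subtype.val (h0 hr))
    rw [h2, ← FractionalIdeal.coeIdeal_top, FractionalIdeal.coeIdeal_le_coeIdeal] at h3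
    exact RingHom.ker_ne_top φ (top_le_iff.1 h3)
  · rw [hI', ← FractionalIdeal.spanSingleton_mul_spanSingleton, mul_assoc,
      spanSingleton_inv_mul_cancel_left hw0]

theorem range_preimageCl :
    (preimageCl φ hφ D hU star).range = (extendCl φ hφ D hD star).ker := by
  ext c
  rw [MonoidHom.mem_range, MonoidHom.mem_ker]
  constructor
  · rintro ⟨c, rfl⟩
    obtain ⟨⟨J, hJ⟩, rfl⟩ := QuotientGroup.mk_surjective c
    rw [preimageCl_cls, extendCl_cls]
    refine (cls_congr _ ?_).trans
      (cls_spanSingleton _ one_ne_zero (isInvertibleStarIdeal_spanSingleton _ 1))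
    rw [extendIdeal_preimageIdeal φ hφ D hU hJ.1, FractionalIdeal.spanSingleton_one]
  · intro hc
    obtain ⟨⟨H, hH⟩, rfl⟩ := QuotientGroup.mk_surjective c
    rw [extendCl_cls] at hc
    obtain ⟨x, -, hx⟩ := exists_of_cls_eq_one _ hc
    obtain ⟨z, I, hz, hI, rfl, hI1⟩ :=
      exists_eq_smul_of_extendIdeal_eq φ hφ D hD hU star hH hx
    have hI' := (star.isInvertibleStarIdeal_smul_iff hz).1 hH
    -- The preimage of [H] is the class of φ(I)^{*_φ}, since φ⁻¹ of it is (φ⁻¹(φ(I)))^* = I^* = I.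
    refine ⟨StarOperation.cls _ _
      (isInvertibleStarIdeal_proj_map φ hφ D hD star hH hz hI rfl), ?_⟩
    refine Eq.trans ?_ (cls_smul star hI' hz hH).symm
    rw [preimageCl_cls]
    refine cls_congr _ ?_
    rw [← map_preimageIdeal φ hφ D hU star (coeIdeal_map_ne_zero φ D hI),
      ← coeIdeal_eq_preimageIdeal φ hφ D hI1, hI'.2.1]

end Splitting

/-! ### Surjectivity of β by contraction of ideals of T to R. -/

section Surjectivity

variable {T K k : Type*} [CommRing T] [IsDomain T] [Field K] [Algebra T K] [IsFractionRing T K]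
  [Field k] (φ : T →+* k) (hφ : Function.Surjective φ) [Fact (RingHom.ker φ ≠ ⊥)] (D : Subring k)
  (hD : D ≠ ⊤) (star : StarOperation (pullbackRing φ D) K)

open StarOperation

/-- The contraction `E ∩ R` of an ideal `E` of `T`. -/
abbrev contract (E : Ideal T) : Ideal (pullbackRing φ D) :=
  E.comap (pullbackRing φ D).subtype

include hφ in
theorem exists_mem_map_eq_one {E : Ideal T} (hE : ¬ E ≤ RingHom.ker φ) :
    ∃ e ∈ E, φ e = 1 := by
  obtain ⟨t, ht, h0⟩ := SetLike.not_le_iff_exists.1 hE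
  obtain ⟨b, hb⟩ := hφ (φ t)⁻¹
  exact ⟨b * t, E.mul_mem_left b ht, by rw [map_mul, hb, inv_mul_cancel₀ h0]⟩

theorem mem_pullbackRing_of_map_eq_one {e : T} (he : φ e = 1) : e ∈ pullbackRing φ D := by
  rw [Subring.mem_comap, he]
  exact D.one_mem

include hφ in
theorem not_contract_le_ker {E : Ideal T} (hE : ¬ E ≤ RingHom.ker φ) :
    ¬ contract φ D E ≤ RingHom.ker (pullbackProj φ D) := by
  obtain ⟨e, he, h1⟩ := exists_mem_map_eq_one φ hφ hE
  rw [not_le_ker_iff]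
  exact ⟨⟨e, mem_pullbackRing_of_map_eq_one φ D h1⟩, he, by rw [h1]; exact one_ne_zero⟩

-- With e ∈ E and φ(e) = 1, each t ∈ E is te + (t - te), where e ∈ E ∩ R and t - te ∈ E ∩ M ⊆ E ∩ R.
include hφ in
theorem extendIdeal_contract {E : Ideal T} (hE : ¬ E ≤ RingHom.ker φ) :
    extendIdeal (contract φ D E : FractionalIdeal (pullbackRing φ D)⁰ K) = E := by
  apply le_antisymm
  · rw [extendIdeal_le]
    intro x hx
    obtain ⟨r, hr, rfl⟩ := (FractionalIdeal.mem_coeIdeal _).1 hx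
    exact FractionalIdeal.mem_coeIdeal_of_mem _ hr
  · intro x hx
    obtain ⟨t, ht, rfl⟩ := (FractionalIdeal.mem_coeIdeal _).1 hx
    obtain ⟨e, he, h1⟩ := exists_mem_map_eq_one φ hφ hE
    have key : ∀ r ∈ E, φ r ∈ D → algebraMap T K r ∈
        extendIdeal (contract φ D E : FractionalIdeal (pullbackRing φ D)⁰ K) :=
      fun r hr hrD => mem_extendIdeal (FractionalIdeal.mem_coeIdeal_of_mem
        (x := (⟨r, hrD⟩ : pullbackRing φ D)) _ hr)
    have h2 := key e he (by rw [h1]; exact D.one_mem)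
    have h3 := key (t - t * e) (E.sub_mem ht (E.mul_mem_right e ht))
      (by rw [map_sub, map_mul, h1, mul_one, sub_self]; exact D.zero_mem)
    have h4 := Submodule.add_mem
      (extendIdeal (contract φ D E : FractionalIdeal (pullbackRing φ D)⁰ K) : Submodule T K)
      (Submodule.smul_mem _ t h2) h3
    rwa [Algebra.smul_def, ← map_mul, ← map_add, add_sub_cancel] at h4

-- (E ∩ R)^* lies in R and in the closure of (E ∩ R)T = E, which is E itself.
include hφ hD in
theorem map_contract {E : Ideal T} (hE : ¬ E ≤ RingHom.ker φ)
    (hs : pullbackExtend φ D star (E : FractionalIdeal T⁰ K) = E) :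
    star (contract φ D E : FractionalIdeal (pullbackRing φ D)⁰ K) = contract φ D E := by
  refine le_antisymm (fun x hx => ?_) (star.le_map _)
  obtain ⟨r, rfl⟩ := mem_one_of_le_one (star.map_le_one FractionalIdeal.coeIdeal_le_one) hx
  have h := map_coeIdeal_le_extend φ hφ D star hD (not_contract_le_ker φ hφ D hE) hx
  rw [extendIdeal_contract φ hφ D hE] at h
  have h' : algebraMap (pullbackRing φ D) K r ∈ (E : FractionalIdeal T⁰ K) := hs ▸ h
  obtain ⟨t, ht, h2⟩ := (FractionalIdeal.mem_coeIdeal _).1 h'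
  refine FractionalIdeal.mem_coeIdeal_of_mem _ ?_
  change (r : T) ∈ E
  rwa [← show t = r from IsFractionRing.injective T K h2]

include hφ in
theorem map_contract_mul {E F : Ideal T} (hE : ¬ E ≤ RingHom.ker φ) (hF : ¬ F ≤ RingHom.ker φ)
    {b : T} {d : Dˣ} (hb : φ b = (d : D))
    (h : pullbackExtend φ D star ((E : FractionalIdeal T⁰ K) * F) =
      FractionalIdeal.spanSingleton T⁰ (algebraMap T K b)) :
    star ((contract φ D E : FractionalIdeal (pullbackRing φ D)⁰ K) * contract φ D F) =
      FractionalIdeal.spanSingleton _ (algebraMap T K b) := by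
  have hbD : φ b ∈ D := hb ▸ (d : D).2
  have hd : (((d⁻¹ : Dˣ) : D) : k) * (d : D) = 1 := congrArg Subtype.val d.inv_mul
  have hb0 : b ≠ 0 := by
    rintro rfl
    rw [map_zero] at hb
    rw [← hb, mul_zero] at hd
    exact zero_ne_one hd
  apply le_antisymm
  · rw [← star.map_spanSingleton' (algebraMap T K b) (by simpa using hb0)]
    refine star.mono ?_
    rw [FractionalIdeal.mul_le]
    intro x hx y hy
    obtain ⟨r, hr, rfl⟩ := (FractionalIdeal.mem_coeIdeal _).1 hx
    obtain ⟨q, hq, rfl⟩ := (FractionalIdeal.mem_coeIdeal _).1 hy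
    have h1 := StarOperation.le_map (pullbackExtend φ D star) _ (FractionalIdeal.mul_mem_mul
      (FractionalIdeal.mem_coeIdeal_of_mem (P := K) T⁰ hr)
      (FractionalIdeal.mem_coeIdeal_of_mem T⁰ hq))
    rw [h] at h1
    obtain ⟨t, ht⟩ := (FractionalIdeal.mem_spanSingleton _).1 h1
    rw [Algebra.smul_def, ← map_mul, ← map_mul] at ht
    have h2 : t * b = r * q := IsFractionRing.injective T K ht
    -- From tb = rq and φ(b) = d one gets φ(t) = d⁻¹φ(rq). Here d must be a unit of D, and not just
    -- a nonzero element of k.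
    have htD : φ t ∈ D := by
      have h3 : φ t = ((d⁻¹ : Dˣ) : D) * φ (r * q) := by
        rw [← h2, map_mul, hb, mul_comm (φ t), ← mul_assoc, hd, one_mul]
      rw [h3]
      exact D.mul_mem (Subtype.coe_prop _) (r * q).2
    refine (FractionalIdeal.mem_spanSingleton _).2 ⟨⟨t, htD⟩, ?_⟩
    exact (Algebra.smul_def t _).trans ((map_mul _ _ _).symm.trans (ht.trans (map_mul _ _ _)))
  · rw [FractionalIdeal.spanSingleton_le_iff_mem]
    obtain ⟨e, he, he1⟩ := exists_mem_map_eq_one φ hφ hE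
    obtain ⟨f, hf, hf1⟩ := exists_mem_map_eq_one φ hφ hF
    have h1 : algebraMap T K b ∈ pullbackExtend φ D star ((E : FractionalIdeal T⁰ K) * F) := by
      rw [h]
      exact FractionalIdeal.mem_spanSingleton_self _ _
    have h2 := h1.1
    rw [← extendIdeal_contract φ hφ D hE, ← extendIdeal_contract φ hφ D hF,
      ← extendIdeal_mul] at h2
    -- Split b = (be)f + b(1 - ef). Put P = (E ∩ R)(F ∩ R), so PT = EF. The second term lies in
    -- (PT)^*·M ⊆ (PT·M)^* ⊆ P^*, and the first lies in P.
    have h3 : algebraMap T K b * algebraMap T K (1 - e * f) ∈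
        star ((contract φ D E : FractionalIdeal (pullbackRing φ D)⁰ K) * contract φ D F) := by
      refine ((star.map_mul_le _ _).trans (star.mono ?_)) (FractionalIdeal.mul_mem_mul h2
        ((mem_preimageIdeal_zero φ hφ D).2 ⟨1 - e * f, by simp [he1, hf1], rfl⟩))
      rw [FractionalIdeal.mul_le]
      intro x hx y hy
      obtain ⟨m, hm, rfl⟩ := (mem_preimageIdeal_zero φ hφ D).1 hy
      exact mul_mem_of_mem_extendIdeal φ hφ D hx hm
    have h4 : algebraMap T K (b * e * f) ∈
        star ((contract φ D E : FractionalIdeal (pullbackRing φ D)⁰ K) * contract φ D F) := by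
      refine star.le_map _ ?_
      rw [map_mul]
      refine FractionalIdeal.mul_mem_mul (FractionalIdeal.mem_coeIdeal_of_mem
        (x := (⟨b * e, ?_⟩ : pullbackRing φ D)) _ (E.mul_mem_left b he))
        (FractionalIdeal.mem_coeIdeal_of_mem
        (x := (⟨f, mem_pullbackRing_of_map_eq_one φ D hf1⟩ : pullbackRing φ D)) _ hf)
      rwa [Subring.mem_comap, map_mul, he1, mul_one]
    have h5 := Submodule.add_mem
      (star ((contract φ D E : FractionalIdeal (pullbackRing φ D)⁰ K) * contract φ D F)).1 h4 h3
    rwa [← map_mul, ← map_add, show b * e * f + b * (1 - e * f) = b by ring] at h5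

variable [IsFractionRing D k] (hU : Function.Surjective (unitsQuotientMap φ D))

include hφ hD in
theorem exists_eq_smul_coeIdeal_extend {E : FractionalIdeal T⁰ K}
    (hE : (pullbackExtend φ D star).IsInvertibleStarIdeal E) :
    ∃ (z : K) (E' : Ideal T), z ≠ 0 ∧ ¬ E' ≤ RingHom.ker φ ∧
      E = FractionalIdeal.spanSingleton _ z * (E' : FractionalIdeal T⁰ K) := by
  refine hE.exists_eq_smul (RingHom.ker_ne_top _) fun x hx => ?_
  have h := hx.1
  rw [restrictIdeal_ker φ hφ D] at h
  obtain ⟨t, ht, rfl⟩ := (mem_preimageIdeal_zero φ hφ D).1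
    (map_preimageIdeal_zero_le φ hφ D star hD h)
  exact FractionalIdeal.mem_coeIdeal_of_mem _ ht

include hU in
theorem extendCl_surjective : Function.Surjective (extendCl φ hφ D hD star) := by
  intro c
  obtain ⟨⟨E₀, hE₀⟩, rfl⟩ := QuotientGroup.mk_surjective c
  obtain ⟨z, E, hz, hEM, rfl⟩ := exists_eq_smul_coeIdeal_extend φ hφ D hD star hE₀
  have hE := (isInvertibleStarIdeal_smul_iff _ hz).1 hE₀
  obtain ⟨w, F, hw, hFM, hF⟩ := exists_eq_smul_coeIdeal_extend φ hφ D hD star hE.inv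
  have h1 : pullbackExtend φ D star ((E : FractionalIdeal T⁰ K) * F) =
      FractionalIdeal.spanSingleton _ w⁻¹ := by
    have h2 := hE.2.2
    rw [hF, mul_left_comm, StarOperation.map_smul] at h2
    rw [← spanSingleton_inv_mul_cancel_left hw (StarOperation.toFun _ _), h2, mul_one]
  have hle : (E : FractionalIdeal T⁰ K) * F ≤ 1 := by
    rw [← FractionalIdeal.coeIdeal_mul]
    exact FractionalIdeal.coeIdeal_le_one
  obtain ⟨b, hb⟩ := mem_one_of_le_one (StarOperation.map_le_one _ hle)
    (h1 ▸ FractionalIdeal.mem_spanSingleton_self _ _)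
  rw [← hb] at h1
  have hb0 : φ b ≠ 0 := by
    intro h0
    obtain ⟨e, he, he1⟩ := exists_mem_map_eq_one φ hφ hEM
    obtain ⟨f, hf, hf1⟩ := exists_mem_map_eq_one φ hφ hFM
    have h2 := StarOperation.le_map (pullbackExtend φ D star) _ (FractionalIdeal.mul_mem_mul
      (FractionalIdeal.mem_coeIdeal_of_mem (P := K) T⁰ he)
      (FractionalIdeal.mem_coeIdeal_of_mem T⁰ hf))
    rw [h1] at h2
    obtain ⟨t, ht⟩ := (FractionalIdeal.mem_spanSingleton _).1 h2
    rw [Algebra.smul_def, ← map_mul, ← map_mul] at ht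
    have h3 := congrArg φ (IsFractionRing.injective T K ht)
    rw [map_mul, map_mul, h0, he1, hf1, mul_zero, mul_one] at h3
    exact zero_ne_one h3
  -- The generator b of (EF)^{(*)_T} may be changed by a unit of T. Choosing u with φ(u) = φ(b)⁻¹d
  -- makes φ(bu) = d a unit of D.
  obtain ⟨u, d, hu⟩ := exists_unit_map_eq φ D hU (inv_ne_zero hb0)
  have h2 : FractionalIdeal.spanSingleton T⁰ (algebraMap T K (b * u)) =
      FractionalIdeal.spanSingleton T⁰ (algebraMap T K b) := by
    rw [map_mul]
    apply le_antisymm <;>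
      rw [FractionalIdeal.spanSingleton_le_iff_mem, FractionalIdeal.mem_spanSingleton]
    · exact ⟨u, by rw [Algebra.smul_def, mul_comm]⟩
    · exact ⟨(u⁻¹ : Tˣ).1, by
        rw [Algebra.smul_def, mul_left_comm, ← map_mul, u.inv_mul, _root_.map_one, mul_one]⟩
  rw [← h2] at h1
  have h3 := map_contract_mul φ hφ D star hEM hFM (d := d)
    (by rw [map_mul, hu, mul_inv_cancel_left₀ hb0]) h1
  have h4 : algebraMap T K (b * u) ≠ 0 := by
    rw [map_mul, hb]
    exact mul_ne_zero (inv_ne_zero hw) (by simp)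
  have h5 := star.isInvertibleStarIdeal_map h4 h3
  have hs := map_contract φ hφ D hD star hEM hE.2.1
  rw [hs] at h5
  refine ⟨star.cls _ h5, ?_⟩
  rw [extendCl_cls]
  exact (cls_congr _ (extendIdeal_contract φ hφ D hEM)).trans (cls_smul _ hE hz hE₀).symm

end Surjectivity

/-! ### The split exact sequence. -/

theorem mainTheorem1 {T K k : Type*} [CommRing T] [IsDomain T] [Field K] [Algebra T K]
    [IsFractionRing T K] [Field k]
    (φ : T →+* k) (hφ : Function.Surjective φ) [Fact (RingHom.ker φ ≠ ⊥)]
    (D : Subring k) (hD : D ≠ ⊤) [IsFractionRing D k]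
    (hU : Function.Surjective (unitsQuotientMap φ D))
    (star : StarOperation (pullbackRing φ D) K) (hstar : star.IsFiniteType) :
    ∃ (α : (star.proj (L := k) (pullbackProj φ D) (pullbackProj_surjective φ D hφ)).Cl →* star.Cl)
      (β : star.Cl →* (star.extend (pullback_conductor φ D)).Cl)
      (γ : star.Cl →*
        (star.proj (L := k) (pullbackProj φ D) (pullbackProj_surjective φ D hφ)).Cl),
      -- `α [J] = [φ⁻¹(J)]`
      (∀ (J : FractionalIdeal D⁰ k) (hJ : StarOperation.IsInvertibleStarIdeal _ J),
        ∃ hI : star.IsInvertibleStarIdeal (preimageIdeal φ hφ D K J),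
          α (StarOperation.cls _ J hJ) = star.cls _ hI) ∧
      -- `β [H] = [HT]`
      (∀ (H : FractionalIdeal (pullbackRing φ D)⁰ K) (hH : star.IsInvertibleStarIdeal H),
        ∃ hG : StarOperation.IsInvertibleStarIdeal _ (StarOperation.extendIdeal H),
          β (star.cls H hH) = StarOperation.cls _ _ hG) ∧
      -- `γ [H] = [φ(H')^v]` for `H = z H'` with `H' ⊆ R` and `H' ⊄ M`; such `z`, `H'` exist
      (∀ (H : FractionalIdeal (pullbackRing φ D)⁰ K) (hH : star.IsInvertibleStarIdeal H),
        (∃ (z : K) (H' : Ideal (pullbackRing φ D)), z ≠ 0 ∧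
          ¬ H' ≤ RingHom.ker (pullbackProj φ D) ∧
          H = FractionalIdeal.spanSingleton _ z * (H' : FractionalIdeal (pullbackRing φ D)⁰ K)) ∧
        ∀ (z : K) (H' : Ideal (pullbackRing φ D)), z ≠ 0 →
          ¬ H' ≤ RingHom.ker (pullbackProj φ D) →
          H = FractionalIdeal.spanSingleton _ z * (H' : FractionalIdeal (pullbackRing φ D)⁰ K) →
          ∃ hJ : StarOperation.IsInvertibleStarIdeal _
              ((((H'.map (pullbackProj φ D) : Ideal D) : FractionalIdeal D⁰ k)⁻¹)⁻¹),
            γ (star.cls H hH) = StarOperation.cls _ _ hJ) ∧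
      -- split exactness
      Function.Injective α ∧ α.range = β.ker ∧ Function.Surjective β ∧
      γ.comp α = MonoidHom.id _ := by

  refine ⟨preimageCl φ hφ D hU star, extendCl φ hφ D hD star, projCl φ hφ D hD star,
    fun J hJ => ⟨_, preimageCl_cls φ hφ D hU star hJ⟩,
    fun H hH => ⟨_, extendCl_cls φ hφ D hD star hH⟩,
    fun H hH => ⟨exists_eq_smul_coeIdeal φ hφ D hD star hH, fun z I hz hI h => ?_⟩,
    ?_, range_preimageCl φ hφ D hD hU star, extendCl_surjective φ hφ D hD star hU,
    projCl_comp_preimageCl φ hφ D hD hU star⟩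
  · have hJ := isInvertibleStarIdeal_proj_map φ hφ D hD star hH hz hI h
    -- The class was built with φ(H')^{*_φ}, which equals φ(H')^{v_D} because it is *_φ-invertible.
    have hv := StarOperation.inv_inv_eq_map _ hJ
    exact ⟨hv ▸ hJ, (projCl_cls φ hφ D hD star hH hz hI h).trans
      (StarOperation.cls_congr _ hv.symm)⟩
  · exact Function.LeftInverse.injective
      (DFunLike.congr_fun (projCl_comp_preimageCl φ hφ D hD hU star))
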